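/- Let $X$ be a complex Banach space and let $S$ be a linear operator in $X$ with (not necessarily dense) domain $\mathcal D(S)\subset X$. Let $\varrho(S)$ be the set of $\lambda\in\mathbb C$ for which $S-\lambda:\mathcal D(S)\to X$ is bijective with bounded inverse, and $\sigma(S)=\mathbb C\setminus\varrho(S)$. Write $\mathbb C_+$, $\mathbb C_-$ for the open right and left half-planes. Suppose that for some $h>0$ $$\{\lambda\in\mathbb C:|\operatorname{Re}\lambda|\le h\}\subset\varrho(S)\quad\text{and}\quad \sup_{|\operatorname{Re}\lambda|\le h}\|(S-\lambda)^{-1}\|<\infty .$$ Let $G_\pm$ be the subspace of all $x\in X$ for which $\lambda\mapsto(S-\lambda)^{-1}x$, $\lambda\in\varrho(S)$, has an analytic extension to $\overline{\mathbb C_\mp}\cup\varrho(S)$ that is bounded on $\overline{\mathbb C_\mp}$. Put $$A_+=\frac1{2\pi i}\int_{h-i\infty}^{h+i\infty}\frac1{\lambda^2}(S-\lambda)^{-1}\,d\lambda ,\qquad P_+=S^2A_+,\qquad \mathcal D(P_+)=\{x\in X: A_+x\in\mathcal D(S^2)\},$$ where the integral converges in operator norm. Given closed subspaces $X_\pm$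 with $X=X_+\oplus X_-$, the operator $S$ is called strictly dichotomous with respect to $X=X_+\oplus X_-$ if $i\mathbb R\subset\varrho(S)$; $S(\mathcal D(S)\cap X_\pm)\subset X_\pm$; the restrictions $S|X_\pm$ (operators in $X_\pm$ with domain $\mathcal D(S)\cap X_\pm$) satisfy $\sigma(S|X_\pm)\subset\mathbb C_\pm$; and $\|(S|X_\pm-\lambda)^{-1}\|$ is bounded on $\overline{\mathbb C_\mp}$. It is called strictly dichotomous if this holds for some such decomposition. Then the following are equivalent: (i) $S$ is strictly dichotomous; (ii) $X=G_+\oplus G_-$ (algebraic direct sum); (iii) $P_+\in L(X)$, i.e. $P_+$ is everywhere defined and bounded. In this case $X=G_+\oplus G_-$ is the corresponding spectral decomposition: $S$ is strictly dichotomous with respect to $X=G_+\oplus G_-$ and with respect to no other decomposition. -/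

import Mathlib

noncomputable section

namespace Dichotomy

variable {X : Type*} [NormedAddCommGroup X] [NormedSpace ℂ X]

/-- The bounded operator `R` is a two-sided inverse `(S - l)⁻¹ : X → D(S)` of `S - l`. -/
def IsResolvent (S : X →ₗ.[ℂ] X) (l : ℂ) (R : X →L[ℂ] X) : Prop :=
  (∀ y : X, ∃ hy : R y ∈ S.domain, S ⟨R y, hy⟩ - l • R y = y) ∧
    ∀ x : S.domain, R (S x - l • (x : X)) = x

/-- The resolvent set `ϱ(S)`: all `l` such that `S - l` has a bounded everywhere defined inverse. -/
def rho (S : X →ₗ.[ℂ] X) : Set ℂ := {l | ∃ R : X →L[ℂ] X, IsResolvent S l R}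

/-- The spectrum `σ(S)`. -/
def spec (S : X →ₗ.[ℂ] X) : Set ℂ := (rho S)ᶜ

open Classical in
/-- The resolvent `(S - l)⁻¹` for `l ∈ ϱ(S)`, with value `0` outside `ϱ(S)`. -/
def resolv (S : X →ₗ.[ℂ] X) (l : ℂ) : X →L[ℂ] X :=
  if h : l ∈ rho S then h.choose else 0

/-- `S(D(S) ∩ Y) ⊆ Y`. -/
def Invariant (S : X →ₗ.[ℂ] X) (Y : Submodule ℂ X) : Prop :=
  ∀ x : S.domain, (x : X) ∈ Y → S x ∈ Y

/-- The restriction `S|Y` as an operator in the invariant subspace `Y`, with domain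
`D(S) ∩ Y`. -/
def restr (S : X →ₗ.[ℂ] X) (Y : Submodule ℂ X) (hY : Invariant S Y) : Y →ₗ.[ℂ] Y where
  domain := S.domain.comap Y.subtype
  toFun :=
    { toFun := fun y => ⟨S ⟨((y : Y) : X), y.2⟩, hY _ (y : Y).2⟩
      map_add' := fun a b => Subtype.ext (S.map_add ⟨((a : Y) : X), a.2⟩ ⟨((b : Y) : X), b.2⟩)
      map_smul' := fun c a => Subtype.ext (S.map_smul c ⟨((a : Y) : X), a.2⟩) }

/-- `S` is strictly dichotomous with respect to the decomposition `X = Xp ⊕ Xm`. -/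
structure IsStrictlyDichotomousWrt (S : X →ₗ.[ℂ] X) (Xp Xm : Submodule ℂ X) : Prop where
  closed_plus : IsClosed (Xp : Set X)
  closed_minus : IsClosed (Xm : Set X)
  isCompl : IsCompl Xp Xm
  imaginary_axis : ∀ l : ℂ, l.re = 0 → l ∈ rho S
  inv_plus : Invariant S Xp
  inv_minus : Invariant S Xm
  spec_plus : spec (restr S Xp inv_plus) ⊆ {l | 0 < l.re}
  spec_minus : spec (restr S Xm inv_minus) ⊆ {l | l.re < 0}
  bound_plus : ∃ M : ℝ, ∀ l : ℂ, l.re ≤ 0 → ‖resolv (restr S Xp inv_plus) l‖ ≤ M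
  bound_minus : ∃ M : ℝ, ∀ l : ℂ, 0 ≤ l.re → ‖resolv (restr S Xm inv_minus) l‖ ≤ M

/-- `S` is strictly dichotomous (with respect to some decomposition). -/
def IsStrictlyDichotomous (S : X →ₗ.[ℂ] X) : Prop :=
  ∃ Xp Xm : Submodule ℂ X, IsStrictlyDichotomousWrt S Xp Xm

/-- All `x` such that `l ↦ (S - l)⁻¹ x` on `ϱ(S)` has an analytic extension to `U ∪ ϱ(S)`
that is bounded on `U`. -/
def extSubspace (S : X →ₗ.[ℂ] X) (U : Set ℂ) : Submodule ℂ X where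
  carrier := {x | ∃ φ : ℂ → X, AnalyticOnNhd ℂ φ (U ∪ rho S) ∧
    (∀ l ∈ rho S, φ l = resolv S l x) ∧ ∃ C : ℝ, ∀ l ∈ U, ‖φ l‖ ≤ C}
  zero_mem' := ⟨fun _ => 0, analyticOnNhd_const, by simp, 0, by simp⟩
  add_mem' := by
    rintro a b ⟨φ, hφ, hφa, C, hC⟩ ⟨ψ, hψ, hψb, D, hD⟩
    refine ⟨fun l => φ l + ψ l, hφ.add hψ, fun l hl => ?_, C + D, fun l hl => ?_⟩
    · simp only [hφa l hl, hψb l hl, map_add]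
    · exact (norm_add_le _ _).trans (add_le_add (hC l hl) (hD l hl))
  smul_mem' := by
    rintro c a ⟨φ, hφ, hφa, C, hC⟩
    refine ⟨fun l => c • φ l, analyticOnNhd_const.smul hφ, fun l hl => ?_, ‖c‖ * C,
      fun l hl => ?_⟩
    · simp only [hφa l hl, map_smul]
    · rw [norm_smul]
      exact mul_le_mul_of_nonneg_left (hC l hl) (norm_nonneg c)

/-- `G₊`: bounded analytic extension to the closed left half-plane. -/
def Gplus (S : X →ₗ.[ℂ] X) : Submodule ℂ X := extSubspace S {l | l.re ≤ 0}

/-- `G₋`: bounded analytic extension to the closed right half-plane. -/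
def Gminus (S : X →ₗ.[ℂ] X) : Submodule ℂ X := extSubspace S {l | 0 ≤ l.re}

/-- `A₊ = (1/2πi) ∫_{h-i∞}^{h+i∞} l⁻² (S - l)⁻¹ dl`, with `l = h + it`, `dl = i dt`;
a Bochner integral in the Banach space of bounded operators. -/
def Aplus (S : X →ₗ.[ℂ] X) (h : ℝ) : X →L[ℂ] X :=
  (1 / (2 * (Real.pi : ℂ) * Complex.I)) •
    ∫ t : ℝ, (Complex.I * (1 / ((h : ℂ) + t * Complex.I) ^ 2)) •
      resolv S ((h : ℂ) + t * Complex.I)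

/-- The product `T B` of an operator `T` and a bounded operator `B`, with its natural domain
`{x | B x ∈ D(T)}`. -/
def mulBdd (T : X →ₗ.[ℂ] X) (B : X →L[ℂ] X) : X →ₗ.[ℂ] X where
  domain := T.domain.comap B.toLinearMap
  toFun :=
    { toFun := fun x => T ⟨B (x : X), x.2⟩
      map_add' := fun a b => by
        rw [← T.map_add]
        congr 1
        exact Subtype.ext (B.map_add _ _)
      map_smul' := fun c a => by
        rw [RingHom.id_apply, ← T.map_smul]
        congr 1
        exact Subtype.ext (B.map_smul _ _) }

/-- `S²` with its natural domain `{x ∈ D(S) | S x ∈ D(S)}`. -/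
def sq (S : X →ₗ.[ℂ] X) : X →ₗ.[ℂ] X :=
  S.comp (S.domRestrict ((S.domain.comap S.toFun).map S.domain.subtype)) (by
    rintro ⟨x, hx, hx'⟩
    obtain ⟨y, hy, rfl⟩ := hx
    exact hy)

/-- `P₊ = S² A₊`. -/
def Pplus (S : X →ₗ.[ℂ] X) (h : ℝ) : X →ₗ.[ℂ] X := mulBdd (sq S) (Aplus S h)

/-- `T ∈ L(X)`: the operator `T` is everywhere defined and bounded. -/
def IsBounded (T : X →ₗ.[ℂ] X) : Prop :=
  ∃ B : X →L[ℂ] X, T = B.toLinearMap.toPMap ⊤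

end Dichotomy

end

noncomputable section

namespace Dichotomy

open Filter Topology MeasureTheory Complex Set

/-! ### Contour integrals along vertical lines -/

section Contour

variable {E : Type*} [NormedAddCommGroup E] [NormedSpace ℂ E]

/-! Write R(λ) = (S - λ)⁻¹, let A₊ be the given integral over Re λ = h, and let A₋ be the integral
of -λ⁻²R(λ)/(2πi) over Re λ = -h. Everything rests on three facts.

(a) A₊ + A₋ = R(0)², the residue of λ⁻²R(λ) at 0 (`lineIntegral_add_reflect`).

(b) G₋ = ker A₊ and G₊ = ker A₋ (`hasBoundedExtension_iff`). If R(·)x has a bounded extension φ to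
the right half-plane, the line of integration of λ⁻²φ(λ) can be pushed to +∞, so A₊x = 0.
Conversely, A₊x = 0 gives A₋x = R(0)²x, and R(λ)x = λ²R(λ)A₋x + λR(0)²x + R(0)x. By the resolvent
identity R(λ)A₋ is a Cauchy-type integral over Re = -h, which continues to all of Re λ > -h and is
bounded for Re λ ≥ 0. So R(·)x continues with at most quadratic growth, and Phragmén–Lindelöf
improves this to the bound it has on the imaginary axis.

(c) A₊A₋ = A₋A₊ = 0, because the same Cauchy integral puts the range of A₋ into G₋
(`lineIntegral_mul_reflect`).

Since R(0) is injective, (a) and (b) give G₊ ∩ G₋ = 0. The G± are closed and S-invariant, and the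
continued R(λ) is the resolvent of S|G₋, with the same bound; so (ii) implies (i). For any
dichotomous decomposition the resolvents of the restrictions supply bounded extensions, whence X± ⊆
G±, and disjointness of G₊ and G₋ forces equality: this is (i) ⇒ (ii) and uniqueness. If X = G₊ ⊕ G₋
with bounded projection B onto G₊, then A₊ = R(0)²B, so P₊ = B. Conversely, if y = P₊x then R(0)²y =
A₊x and R(0)²(x - y) = A₋x, so (c) places y in G₊ and x - y in G₋.

The plus side is always the minus side for -S, whose resolvent is `reflect`. The analytic core
therefore treats an abstract `StripResolvent`, a notion stable under reflection. -/

theorem integrable_inv_sq_add_sq {b : ℝ} (hb : 0 < b) :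
    Integrable fun t : ℝ => (b ^ 2 + t ^ 2)⁻¹ := by
  have h := (integrable_inv_one_add_sq.comp_div hb.ne').const_mul (b ^ 2)⁻¹
  refine h.congr (Eventually.of_forall fun t => ?_)
  simp only
  rw [← mul_inv]
  congr 1
  field_simp

theorem integral_inv_sq_add_sq {b : ℝ} (hb : 0 < b) :
    ∫ t : ℝ, (b ^ 2 + t ^ 2)⁻¹ = Real.pi / b := by
  have h : ∀ t : ℝ, (b ^ 2 + t ^ 2)⁻¹ = (b ^ 2)⁻¹ * (1 + (t / b) ^ 2)⁻¹ := fun t => by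
    rw [← mul_inv]
    congr 1
    field_simp
  simp_rw [h]
  rw [integral_const_mul, Measure.integral_comp_div (fun x : ℝ => (1 + x ^ 2)⁻¹) b,
    integral_univ_inv_one_add_sq, abs_of_pos hb, smul_eq_mul]
  field_simp

theorem integrable_of_norm_le_inv_one_add_sq {E : Type*} [NormedAddCommGroup E]
    {g : ℝ → E} (hg : Continuous g) {C : ℝ}
    (hC : ∀ t, ‖g t‖ ≤ C * (1 + t ^ 2)⁻¹) : Integrable g :=
  (integrable_inv_one_add_sq.const_mul C).mono' hg.aestronglyMeasurable
    (Eventually.of_forall hC)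

theorem continuous_vertical {E : Type*} [TopologicalSpace E]
    {f : ℂ → E} {s : Set ℂ} (hf : ContinuousOn f s) {a : ℝ}
    (ha : ∀ z : ℂ, z.re = a → z ∈ s) : Continuous fun t : ℝ => f (a + t * I) :=
  hf.comp_continuous (by fun_prop) fun t => ha _ (by simp)

/-- The integral along vertical lines of a quadratically decaying holomorphic function does not
depend on the line. -/
theorem integral_vertical_eq [CompleteSpace E] {f : ℂ → E} {a b C : ℝ} (hab : a ≤ b)
    (hc : ContinuousOn f {z | a ≤ z.re ∧ z.re ≤ b})
    (hd : DifferentiableOn ℂ f {z | a < z.re ∧ z.re < b})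
    (hC : ∀ z : ℂ, a ≤ z.re → z.re ≤ b → ‖f z‖ ≤ C * (1 + z.im ^ 2)⁻¹) :
    ∫ t : ℝ, f (a + t * I) = ∫ t : ℝ, f (b + t * I) := by
  have hia : Integrable fun t : ℝ => f (a + t * I) :=
    integrable_of_norm_le_inv_one_add_sq
      (continuous_vertical hc fun z hz => ⟨hz.ge, hz.le.trans hab⟩)
      fun t => by simpa using hC (a + t * I) (by simp) (by simpa using hab)
  have hib : Integrable fun t : ℝ => f (b + t * I) :=
    integrable_of_norm_le_inv_one_add_sq
      (continuous_vertical hc fun z hz => ⟨hab.trans hz.ge, hz.le⟩)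
      fun t => by simpa using hC (b + t * I) (by simpa using hab) (by simp)
  have hrect : ∀ T : ℝ, (∫ x : ℝ in a..b, f (x + (-T : ℝ) * I)) -
      (∫ x : ℝ in a..b, f (x + T * I)) + I • (∫ y : ℝ in -T..T, f (b + y * I)) -
      I • (∫ y : ℝ in -T..T, f (a + y * I)) = 0 := fun T => by
    have := integral_boundary_rect_eq_zero_of_continuousOn_of_differentiableOn f
      (⟨a, -T⟩ : ℂ) ⟨b, T⟩ (hc.mono ?_) (hd.mono ?_)
    · simpa only using this
    · intro z hz
      have := (mem_reProdIm.1 hz).1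
      simp only [uIcc_of_le hab] at this
      exact this
    · intro z hz
      have := (mem_reProdIm.1 hz).1
      simp only [min_eq_left hab, max_eq_right hab] at this
      exact this
  have hbd : ∀ T : ℝ, ‖∫ x : ℝ in a..b, f (x + T * I)‖ ≤ C * (1 + T ^ 2)⁻¹ * |b - a| :=
    fun T => by
      refine intervalIntegral.norm_integral_le_of_norm_le_const fun x hx => ?_
      rw [uIoc_of_le hab] at hx
      simpa using hC (x + T * I) (by simpa using hx.1.le) (by simpa using hx.2)
  have hlim : Tendsto (fun T : ℝ => C * (1 + T ^ 2)⁻¹ * |b - a|) atTop (𝓝 0) := by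
    have h1 : Tendsto (fun T : ℝ => (1 + T ^ 2)⁻¹) atTop (𝓝 0) :=
      tendsto_inv_atTop_zero.comp
        (tendsto_atTop_add_const_left _ _ (tendsto_pow_atTop two_ne_zero))
    simpa using (h1.const_mul C).mul_const |b - a|
  have ht : Tendsto (fun T : ℝ => ∫ x : ℝ in a..b, f (x + T * I)) atTop (𝓝 0) :=
    squeeze_zero_norm hbd hlim
  have ht' : Tendsto (fun T : ℝ => ∫ x : ℝ in a..b, f (x + (-T : ℝ) * I)) atTop (𝓝 0) :=
    squeeze_zero_norm (fun T => by simpa using hbd (-T)) hlim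
  have hA := intervalIntegral_tendsto_integral hia tendsto_neg_atTop_atBot tendsto_id
  have hB := intervalIntegral_tendsto_integral hib tendsto_neg_atTop_atBot tendsto_id
  have htot := ((ht'.sub ht).add (hB.const_smul I)).sub (hA.const_smul I)
  have h0 := tendsto_nhds_unique (htot.congr fun T => hrect T) tendsto_const_nhds
  rw [sub_self, zero_add, ← smul_sub, smul_eq_zero] at h0
  exact (sub_eq_zero.1 (h0.resolve_left I_ne_zero)).symm

theorem div_norm_sq_le {a C : ℝ} (ha : 0 < a) (hC : 0 ≤ C) {z : ℂ} (hz : a ≤ |z.re|) :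
    C / ‖z‖ ^ 2 ≤ C * (1 + (a ^ 2)⁻¹) * (1 + z.im ^ 2)⁻¹ := by
  have h1 : ‖z‖ ^ 2 = z.re ^ 2 + z.im ^ 2 := by
    rw [Complex.sq_norm, normSq_apply]; ring
  have h2 : a ^ 2 ≤ z.re ^ 2 := by
    rw [← sq_abs z.re]; gcongr
  have ha2 : 0 < a ^ 2 := by positivity
  have hz2 : 0 < z.re ^ 2 + z.im ^ 2 := by nlinarith [sq_nonneg z.im]
  rw [h1, mul_assoc, div_eq_mul_inv]
  refine mul_le_mul_of_nonneg_left ?_ hC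
  rw [← div_eq_mul_inv, inv_le_comm₀ hz2 (by positivity), inv_div,
    div_le_iff₀ (by positivity)]
  have h3 : 1 ≤ (a ^ 2)⁻¹ * z.re ^ 2 := by
    rw [← div_eq_inv_mul, le_div_iff₀ ha2]; linarith
  have h4 : 0 ≤ (a ^ 2)⁻¹ * z.im ^ 2 := by positivity
  nlinarith [sq_nonneg z.re]

/-- The integral along a vertical line of a function that is holomorphic to the right of the line
and decays quadratically vanishes. -/
theorem integral_vertical_eq_zero [CompleteSpace E] {f : ℂ → E} {a C : ℝ} (ha : 0 < a)
    (hc : ContinuousOn f {z | a ≤ z.re}) (hd : DifferentiableOn ℂ f {z | a < z.re})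
    (hC : ∀ z : ℂ, a ≤ z.re → ‖f z‖ ≤ C / ‖z‖ ^ 2) :
    ∫ t : ℝ, f (a + t * I) = 0 := by
  have hC0 : 0 ≤ C := by
    by_contra hneg
    have h1 := (norm_nonneg _).trans (hC a (by simp))
    have h2 : C / ‖(a : ℂ)‖ ^ 2 < 0 :=
      div_neg_of_neg_of_pos (not_le.1 hneg) (by simpa using pow_pos ha 2)
    linarith
  -- Moving the line to Re = b turns the bound C/‖z‖² into C/(b² + t²), whose integral Cπ/b tends to
  -- 0 as b → ∞.
  have hle : ∀ b : ℝ, a ≤ b → ‖∫ t : ℝ, f (a + t * I)‖ ≤ C * (Real.pi / b) := fun b hab => by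
    have hb : 0 < b := ha.trans_le hab
    rw [integral_vertical_eq (C := C * (1 + (a ^ 2)⁻¹)) hab (hc.mono fun z hz => hz.1)
      (hd.mono fun z hz => hz.1) fun z h1 h2 => (hC z h1).trans
        (div_norm_sq_le ha hC0 (h1.trans (le_abs_self _))), ← integral_inv_sq_add_sq hb,
      ← integral_const_mul]
    refine norm_integral_le_of_norm_le ((integrable_inv_sq_add_sq hb).const_mul C)
      (Eventually.of_forall fun t => ?_)
    refine (hC _ (by simpa using hab)).trans_eq ?_
    rw [Complex.sq_norm, normSq_apply, div_eq_mul_inv]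
    simp [← pow_two]
  have hlim : Tendsto (fun b : ℝ => C * (Real.pi / b)) atTop (𝓝 0) := by
    simpa using (tendsto_const_nhds (x := Real.pi)).div_atTop tendsto_id |>.const_mul C
  exact norm_le_zero_iff.1 (ge_of_tendsto hlim
    ((eventually_ge_atTop a).mono fun b hb => hle b hb))

end Contour

/-! ### Phragmén–Lindelöf and the identity theorem on half-planes -/

section HalfPlane

variable {E : Type*} [NormedAddCommGroup E] [NormedSpace ℂ E]

/-- A Phragmén–Lindelöf principle for functions of quadratic growth. -/
theorem norm_le_of_quadratic_growth {f : ℂ → E} {C K : ℝ}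
    (hd : DiffContOnCl ℂ f {z | 0 < z.re})
    (hK : ∀ z : ℂ, 0 ≤ z.re → ‖f z‖ ≤ K * (1 + ‖z‖) ^ 2)
    (hC : ∀ z : ℂ, z.re = 0 → ‖f z‖ ≤ C) {z : ℂ} (hz : 0 ≤ z.re) : ‖f z‖ ≤ C := by
  have hK0 : 0 ≤ K := by simpa using (norm_nonneg _).trans (hK 0 le_rfl)
  -- Dividing by (1 + εz)³, of modulus at least 1 on the half-plane, makes a function of quadratic
  -- growth tend to 0 along the positive real axis without enlarging the bound on the imaginary
  -- axis; ε → 0 removes the factor.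
  have key : ∀ ε : ℝ, 0 < ε → ‖f z‖ ≤ C * ‖1 + ε * z‖ ^ 3 := fun ε hε => by
    have hge : ∀ w : ℂ, 0 ≤ w.re → 1 ≤ ‖1 + ε * w‖ := fun w hw => by
      refine le_trans ?_ (re_le_norm _)
      simp only [add_re, one_re, mul_re, ofReal_re, ofReal_im, zero_mul, sub_zero]
      nlinarith
    have hne : ∀ w : ℂ, 0 ≤ w.re → (1 + ε * w) ^ 3 ≠ 0 := fun w hw =>
      pow_ne_zero _ (norm_pos_iff.1 (one_pos.trans_le (hge w hw)))
    have hcl : closure {z : ℂ | 0 < z.re} ⊆ {z | 0 ≤ z.re} :=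
      closure_minimal (fun z hz => le_of_lt (mem_ofPred.1 hz)) (isClosed_le continuous_const continuous_re)
    have hnorm : ∀ w : ℂ, 0 ≤ w.re → ‖((1 + ε * w) ^ 3)⁻¹ • f w‖ ≤ ‖f w‖ := fun w hw => by
      rw [norm_smul, norm_inv, norm_pow]
      exact mul_le_of_le_one_left (norm_nonneg _) (inv_le_one_of_one_le₀ (one_le_pow₀ (hge w hw)))
    have hg : ‖((1 + ε * z) ^ 3)⁻¹ • f z‖ ≤ C := by
      refine PhragmenLindelof.right_half_plane_of_tendsto_zero_on_real
        (f := fun w => ((1 + ε * w) ^ 3)⁻¹ • f w) ?_ ⟨1, by norm_num, 2, ?_⟩ ?_ ?_ hz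
      · refine DiffContOnCl.smul (DiffContOnCl.inv ?_ fun w hw => hne w (hcl hw)) hd
        exact Differentiable.diffContOnCl (by fun_prop)
      · refine Asymptotics.IsBigO.of_bound K ?_
        filter_upwards [mem_inf_of_right (mem_principal_self _)] with w hw
        refine (hnorm w (le_of_lt hw)).trans ((hK w (le_of_lt hw)).trans ?_)
        rw [Real.norm_of_nonneg (Real.exp_pos _).le, Real.rpow_one, two_mul, Real.exp_add, ← pow_two]
        gcongr
        rw [add_comm]
        exact Real.add_one_le_exp _
      · have hb : ∀ᶠ x : ℝ in atTop, ‖((1 + ε * (x : ℂ)) ^ 3)⁻¹ • f x‖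
            ≤ K * 4 * (ε ^ 3)⁻¹ * x⁻¹ := by
          filter_upwards [eventually_ge_atTop 1] with x hx
          have hx0 : 0 < x := one_pos.trans_le hx
          have h1 : ‖f x‖ ≤ K * (1 + x) ^ 2 := by
            simpa [abs_of_pos hx0] using hK x (by simpa using hx0.le)
          have h2 : ‖(1 + ε * (x : ℂ))‖ = 1 + ε * x := by
            rw [← ofReal_mul, ← ofReal_one, ← ofReal_add, norm_real,
              Real.norm_of_nonneg (by positivity)]
          rw [norm_smul, norm_inv, norm_pow, h2, inv_mul_le_iff₀ (by positivity)]
          refine h1.trans ?_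
          have h3 : (ε * x) ^ 3 ≤ (1 + ε * x) ^ 3 := by gcongr; linarith
          have h4 : (1 + x) ^ 2 ≤ 4 * x ^ 2 := by nlinarith
          calc K * (1 + x) ^ 2 ≤ K * (4 * x ^ 2) := by gcongr
            _ = (ε * x) ^ 3 * (K * 4 * (ε ^ 3)⁻¹ * x⁻¹) := by field_simp
            _ ≤ _ := by gcongr
        refine squeeze_zero_norm' hb ?_
        simpa using tendsto_inv_atTop_zero.const_mul (K * 4 * (ε ^ 3)⁻¹)
      · intro x
        exact (hnorm _ (by simp)).trans (hC _ (by simp))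
    rw [norm_smul, norm_inv, norm_pow,
      inv_mul_le_iff₀ (pow_pos (one_pos.trans_le (hge z hz)) 3)] at hg
    linarith
  have hlim : Tendsto (fun ε : ℝ => C * ‖1 + ε * z‖ ^ 3) (𝓝[>] 0) (𝓝 C) := by
    have : ContinuousAt (fun ε : ℝ => C * ‖1 + ε * z‖ ^ 3) 0 := by fun_prop
    simpa using this.tendsto.mono_left nhdsWithin_le_nhds
  exact ge_of_tendsto hlim (eventually_mem_nhdsWithin.mono fun ε hε => key ε hε)

theorem isOpen_lt_re (a : ℝ) : IsOpen {z : ℂ | a < z.re} :=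
  isOpen_lt continuous_const continuous_re

/-- Identity theorem on a half-plane that contains a strip around the imaginary axis. -/
theorem eqOn_halfPlane_of_eqOn_strip [CompleteSpace E] {f g : ℂ → E} {h : ℝ} (hpos : 0 < h)
    (hf : DifferentiableOn ℂ f {z | -h < z.re}) (hg : DifferentiableOn ℂ g {z | -h < z.re})
    (hfg : ∀ z : ℂ, |z.re| < h → f z = g z) {z : ℂ} (hz : -h < z.re) : f z = g z := by
  refine (hf.analyticOnNhd (isOpen_lt_re _)).eqOn_of_preconnected_of_eventuallyEq
    (hg.analyticOnNhd (isOpen_lt_re _))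
    ((convex_halfSpace_gt (r := -h) reLm.isLinear).isPreconnected) (z₀ := 0) (by simpa) ?_ hz
  have : IsOpen {z : ℂ | |z.re| < h} :=
    isOpen_lt (continuous_abs.comp continuous_re) continuous_const
  filter_upwards [this.mem_nhds (x := 0) (by simpa)] with w hw using hfg w hw

end HalfPlane

/-! ### Pseudo-resolvents on a strip and scalar line integrals -/

section Families

variable {X : Type*} [NormedAddCommGroup X] [NormedSpace ℂ X]

/-- An injective pseudo-resolvent on the closed strip `|Re l| ≤ h`, bounded there by `M`. -/
structure StripResolvent (R : ℂ → X →L[ℂ] X) (h M : ℝ) : Prop where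
  pos : 0 < h
  identity : ∀ l m : ℂ, |l.re| ≤ h → |m.re| ≤ h → R l - R m = (l - m) • (R l * R m)
  bound : ∀ l : ℂ, |l.re| ≤ h → ‖R l‖ ≤ M
  eq_zero : ∀ x : X, R 0 x = 0 → x = 0

/-- The family `l ↦ -R(-l)`, which is the resolvent of `-S` if `R` is the resolvent of `S`. -/
def reflect (R : ℂ → X →L[ℂ] X) (l : ℂ) : X →L[ℂ] X := -R (-l)

@[simp]
theorem reflect_reflect (R : ℂ → X →L[ℂ] X) : reflect (reflect R) = R := by
  funext l
  simp [reflect]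

/-- The integral `(1/2πi) ∫ l⁻² R(l) dl` along the line `Re l = h`. -/
def lineIntegral (R : ℂ → X →L[ℂ] X) (h : ℝ) : X →L[ℂ] X :=
  (1 / (2 * (Real.pi : ℂ))) • ∫ t : ℝ, (1 / ((h : ℂ) + t * I) ^ 2) • R ((h : ℂ) + t * I)

/-- The integral `(1/2πi) ∫ l⁻² (l - m)⁻¹ R(l) dl` along the line `Re l = h`. -/
def cauchyIntegral (R : ℂ → X →L[ℂ] X) (h : ℝ) (m : ℂ) : X →L[ℂ] X :=
  (1 / (2 * (Real.pi : ℂ))) • ∫ t : ℝ,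
    (1 / ((h : ℂ) + t * I) ^ 2 * (1 / ((h : ℂ) + t * I - m))) • R ((h : ℂ) + t * I)

/-- The holomorphic continuation of `R` to the right half-plane, valid on the kernel of
`lineIntegral R h`. -/
def continuation (R : ℂ → X →L[ℂ] X) (h : ℝ) (l : ℂ) : X →L[ℂ] X :=
  l ^ 2 • (-cauchyIntegral (reflect R) h (-l)) + l • (R 0 * R 0) + R 0

theorem norm_vertical_sq (h t : ℝ) : ‖(h : ℂ) + t * I‖ ^ 2 = h ^ 2 + t ^ 2 := by
  rw [Complex.sq_norm, normSq_apply]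
  simp [pow_two]

theorem vertical_ne_zero {h : ℝ} (hh : h ≠ 0) (t : ℝ) : (h : ℂ) + t * I ≠ 0 := fun h0 =>
  hh (by simpa using congrArg re h0)

theorem continuous_one_div_vertical_sq {h : ℝ} (hh : h ≠ 0) :
    Continuous fun t : ℝ => 1 / ((h : ℂ) + t * I) ^ 2 :=
  continuous_const.div (by fun_prop) fun t => pow_ne_zero _ (vertical_ne_zero hh t)

theorem norm_one_div_vertical_sq (h t : ℝ) :
    ‖1 / ((h : ℂ) + t * I) ^ 2‖ = (h ^ 2 + t ^ 2)⁻¹ := by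
  rw [norm_div, norm_one, norm_pow, norm_vertical_sq, one_div]

theorem norm_one_div_le {c : ℝ} (hc : 0 < c) {z : ℂ} (hz : c ≤ |z.re|) : ‖1 / z‖ ≤ 1 / c := by
  rw [norm_div, norm_one]
  exact one_div_le_one_div_of_le hc (hz.trans (abs_re_le_norm z))

theorem integral_one_div_vertical_sq {h : ℝ} (hh : 0 < h) :
    ∫ t : ℝ, 1 / ((h : ℂ) + t * I) ^ 2 = 0 := by
  have hne : ∀ z : ℂ, h ≤ z.re → z ^ 2 ≠ 0 := fun z hz =>
    pow_ne_zero _ fun h0 => by rw [h0, zero_re] at hz; linarith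
  refine integral_vertical_eq_zero (f := fun z => 1 / z ^ 2) (C := 1) hh ?_ ?_ fun z hz => ?_
  · exact continuousOn_const.div (by fun_prop) hne
  · exact (differentiableOn_const _).div (by fun_prop) fun z hz => hne z (le_of_lt hz)
  · simp

theorem integral_one_div_vertical_sq_mul {h : ℝ} (hh : 0 < h) {m : ℂ} (hm : m.re < h) :
    ∫ t : ℝ, 1 / ((h : ℂ) + t * I) ^ 2 * (1 / ((h : ℂ) + t * I - m)) = 0 := by
  have hne : ∀ z : ℂ, h ≤ z.re → z ^ 2 ≠ 0 := fun z hz =>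
    pow_ne_zero _ fun h0 => by rw [h0, zero_re] at hz; linarith
  have hne' : ∀ z : ℂ, h ≤ z.re → z - m ≠ 0 := fun z hz h0 => by
    rw [sub_eq_zero.1 h0] at hz; linarith
  refine integral_vertical_eq_zero (f := fun z => 1 / z ^ 2 * (1 / (z - m)))
    (C := 1 / (h - m.re)) hh ?_ ?_ fun z hz => ?_
  · exact (continuousOn_const.div (by fun_prop) hne).mul
      (continuousOn_const.div (by fun_prop) hne')
  · exact ((differentiableOn_const _).div (by fun_prop) fun z hz => hne z (le_of_lt hz)).mul
      ((differentiableOn_const _).div (by fun_prop) fun z hz => hne' z (le_of_lt hz))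
  · rw [norm_mul, div_eq_inv_mul (1 / (h - m.re))]
    gcongr
    · simp
    · refine norm_one_div_le (by linarith) (le_trans ?_ (le_abs_self _))
      simpa using hz

theorem mul_add_two_mul_ne_zero {h : ℝ} (hh : 0 < h) {z : ℂ} (hz : h ≤ z.re) :
    z * (z + 2 * h) ≠ 0 := by
  refine mul_ne_zero (fun h0 => ?_) fun h0 => ?_
  · rw [h0, zero_re] at hz; linarith
  · have := congrArg re h0
    simp only [add_re, mul_re, ofReal_re, re_ofNat, im_ofNat, ofReal_im, zero_re] at this
    linarith

theorem norm_rational_le {h : ℝ} (hh : 0 < h) {z : ℂ} (hz : h ≤ z.re) :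
    ‖2 * (h : ℂ) / (z * (z + 2 * h))‖ ≤ 2 * h / ‖z‖ ^ 2 := by
  have h1 : ‖z‖ ≤ ‖z + 2 * h‖ := by
    rw [← sq_le_sq₀ (norm_nonneg _) (norm_nonneg _), Complex.sq_norm, Complex.sq_norm,
      normSq_apply, normSq_apply]
    simp only [add_re, mul_re, ofReal_re, re_ofNat, im_ofNat, ofReal_im, add_im, mul_im]
    nlinarith
  have h2 : 0 < ‖z‖ := norm_pos_iff.2 fun h0 => mul_add_two_mul_ne_zero hh hz (by simp [h0])
  rw [norm_div, norm_mul, norm_mul, norm_real, Real.norm_of_nonneg hh.le, pow_two]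
  simp only [norm_ofNat]
  gcongr

/-- Both poles, 0 and -2h, lie to the left of the line Re = h. On Re = -h, which separates them, the
integral is -2π; this difference is the residue at 0 in `lineIntegral_add_reflect`. -/
theorem integral_right_line_rational {h : ℝ} (hh : 0 < h) :
    ∫ t : ℝ, 2 * (h : ℂ) / (((h : ℂ) + t * I) * ((h : ℂ) + t * I + 2 * h)) = 0 := by
  refine integral_vertical_eq_zero (f := fun z => 2 * (h : ℂ) / (z * (z + 2 * h)))
    (C := 2 * h) hh ?_ ?_ fun z hz => norm_rational_le hh hz
  · exact continuousOn_const.div (by fun_prop) fun z hz => mul_add_two_mul_ne_zero hh hz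
  · exact (differentiableOn_const _).div (by fun_prop) fun z hz =>
      mul_add_two_mul_ne_zero hh (le_of_lt hz)

theorem integrable_right_line_rational {h : ℝ} (hh : 0 < h) :
    Integrable fun t : ℝ =>
      2 * (h : ℂ) / (((h : ℂ) + t * I) * ((h : ℂ) + t * I + 2 * h)) := by
  refine ((integrable_inv_sq_add_sq hh).const_mul (2 * h)).mono'
    (Continuous.aestronglyMeasurable ?_) (Eventually.of_forall fun t => ?_)
  · exact continuous_const.div (by fun_prop) fun t => mul_add_two_mul_ne_zero hh (by simp)
  · refine (norm_rational_le hh (by simp)).trans_eq ?_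
    rw [norm_vertical_sq, div_eq_mul_inv]

theorem left_line_rational (h t : ℝ) :
    2 * (h : ℂ) / ((((-h : ℝ) : ℂ) + t * I) * (((-h : ℝ) : ℂ) + t * I + 2 * h)) =
      ((-2 * h * (h ^ 2 + t ^ 2)⁻¹ : ℝ) : ℂ) := by
  have h1 : (((-h : ℝ) : ℂ) + t * I) * (((-h : ℝ) : ℂ) + t * I + 2 * h)
      = -((h ^ 2 + t ^ 2 : ℝ) : ℂ) := by
    push_cast
    linear_combination (t : ℂ) ^ 2 * I_sq
  rw [h1, div_neg]
  push_cast
  ring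

theorem integral_left_line_rational {h : ℝ} (hh : 0 < h) :
    ∫ t : ℝ, 2 * (h : ℂ) / ((((-h : ℝ) : ℂ) + t * I) * (((-h : ℝ) : ℂ) + t * I + 2 * h)) =
      -(2 * (Real.pi : ℂ)) := by
  simp_rw [left_line_rational]
  rw [integral_complex_ofReal, integral_const_mul, integral_inv_sq_add_sq hh]
  rw [show -2 * h * (Real.pi / h) = -(2 * Real.pi) by field_simp]
  push_cast
  ring

namespace StripResolvent

variable {R : ℂ → X →L[ℂ] X} {h M : ℝ}

theorem zero_mem (hR : StripResolvent R h M) : |(0 : ℂ).re| ≤ h := by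
  simpa using hR.pos.le

theorem bound_nonneg (hR : StripResolvent R h M) : 0 ≤ M :=
  (norm_nonneg _).trans (hR.bound 0 hR.zero_mem)

theorem mul_comm (hR : StripResolvent R h M) {l m : ℂ} (hl : |l.re| ≤ h) (hm : |m.re| ≤ h) :
    R l * R m = R m * R l := by
  rcases eq_or_ne l m with rfl | hne
  · rfl
  · have h1 := hR.identity l m hl hm
    have h2 := hR.identity m l hm hl
    have h3 : (l - m) • (R l * R m) = (l - m) • (R m * R l) := by
      rw [← h1, ← neg_sub (R m), h2, ← neg_smul, neg_sub]
    exact smul_right_injective _ (sub_ne_zero.2 hne) h3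

theorem reflect (hR : StripResolvent R h M) : StripResolvent (reflect R) h M where
  pos := hR.pos
  identity l m hl hm := by
    have hl' : |(-l).re| ≤ h := by simpa using hl
    have hm' : |(-m).re| ≤ h := by simpa using hm
    have h1 := hR.identity (-m) (-l) hm' hl'
    simp only [Dichotomy.reflect, neg_mul_neg]
    rw [hR.mul_comm hl' hm', neg_sub_neg, h1]
    congr 1
    ring
  bound l hl := by simpa [Dichotomy.reflect] using hR.bound (-l) (by simpa using hl)
  eq_zero x hx := hR.eq_zero x (by simpa [Dichotomy.reflect] using hx)

/-- The resolvent identity and the bound M make R Lipschitz with constant M². -/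
theorem continuousOn (hR : StripResolvent R h M) : ContinuousOn R {z | |z.re| ≤ h} := by
  have hM := hR.bound_nonneg
  refine (LipschitzOnWith.of_dist_le_mul (K := ⟨M * M, by positivity⟩) fun l hl m hm =>
    ?_).continuousOn
  rw [dist_eq_norm, dist_eq_norm, hR.identity l m hl hm, norm_smul, _root_.mul_comm]
  refine mul_le_mul_of_nonneg_right ((norm_mul_le _ _).trans ?_) (norm_nonneg _)
  exact mul_le_mul (hR.bound l hl) (hR.bound m hm) (norm_nonneg _) hM

theorem strip_mem_nhds {l : ℂ} (hl : |l.re| < h) : {z : ℂ | |z.re| ≤ h} ∈ 𝓝 l :=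
  mem_of_superset ((isOpen_lt (continuous_abs.comp continuous_re) continuous_const).mem_nhds hl)
    fun _ hz => le_of_lt (mem_ofPred.1 hz)

theorem hasDerivAt (hR : StripResolvent R h M) {l : ℂ} (hl : |l.re| < h) :
    HasDerivAt R (R l * R l) l := by
  rw [hasDerivAt_iff_tendsto_slope]
  have hcont : ContinuousAt R l := hR.continuousOn.continuousAt (strip_mem_nhds hl)
  have ht : Tendsto (fun m => R m * R l) (𝓝[≠] l) (𝓝 (R l * R l)) :=
    (hcont.tendsto.mul_const _).mono_left nhdsWithin_le_nhds
  refine ht.congr' ?_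
  filter_upwards [eventually_mem_nhdsWithin, mem_nhdsWithin_of_mem_nhds (strip_mem_nhds hl)]
    with m hm hm'
  rw [slope_def_module, hR.identity m l hm' hl.le, smul_smul,
    inv_mul_cancel₀ (sub_ne_zero.2 hm), one_smul]

theorem differentiableAt (hR : StripResolvent R h M) {l : ℂ} (hl : |l.re| < h) :
    DifferentiableAt ℂ R l :=
  (hR.hasDerivAt hl).differentiableAt

theorem continuous_line (hR : StripResolvent R h M) {a : ℝ} (ha : |a| ≤ h) :
    Continuous fun t : ℝ => R (a + t * I) :=
  continuous_vertical hR.continuousOn fun z hz => by simpa [hz] using ha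

theorem integrable_line (hR : StripResolvent R h M) {a : ℝ} (ha : |a| = h) :
    Integrable fun t : ℝ => (1 / ((a : ℂ) + t * I) ^ 2) • R (a + t * I) := by
  have ha0 : a ≠ 0 := fun h0 => by rw [h0, abs_zero] at ha; exact hR.pos.ne ha
  refine ((integrable_inv_sq_add_sq hR.pos).mul_const M).mono'
    ((continuous_one_div_vertical_sq ha0).smul (hR.continuous_line ha.le)).aestronglyMeasurable
    (Eventually.of_forall fun t => ?_)
  rw [norm_smul, norm_one_div_vertical_sq, ← ha, sq_abs]
  gcongr
  exact hR.bound _ (by simpa using ha.le)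

end StripResolvent

end Families

/-! ### The residue identity A₊ + A₋ = R(0)² -/

section Residue

variable {X : Type*} [NormedAddCommGroup X] [NormedSpace ℂ X]

namespace StripResolvent

variable {R : ℂ → X →L[ℂ] X} {h M : ℝ}

theorem eq_add_smul (hR : StripResolvent R h M) {l : ℂ} (hl : |l.re| ≤ h) :
    R l = R 0 + l • (R 0 * R l) := by
  have := hR.identity l 0 hl hR.zero_mem
  rw [sub_zero, hR.mul_comm hl hR.zero_mem] at this
  rw [← this]
  abel

/-- The resolvent identity at 0, used twice. Divided by l² it exhibits the principal part at 0; read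
as it stands it is the formula behind `continuation`. -/
theorem eq_quadratic (hR : StripResolvent R h M) {l : ℂ} (hl : |l.re| ≤ h) :
    R l = l ^ 2 • (R 0 * R 0 * R l) + l • (R 0 * R 0) + R 0 := by
  conv_lhs => rw [hR.eq_add_smul hl, hR.eq_add_smul hl]
  rw [mul_add, mul_smul_comm, smul_add, smul_smul, ← mul_assoc, pow_two]
  abel

/-- `l⁻² R(l)` with its principal part at `0` removed by functions decaying quadratically. -/
def regularPart (R : ℂ → X →L[ℂ] X) (h : ℝ) (z : ℂ) : X →L[ℂ] X :=
  R 0 * R 0 * R z + (1 / (z + 2 * h)) • (R 0 * R 0)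

theorem add_two_mul_ne_zero (hh : 0 < h) {z : ℂ} (hz : |z.re| ≤ h) : z + 2 * h ≠ 0 := fun h0 => by
  have h1 := congrArg re h0
  simp only [add_re, mul_re, ofReal_re, re_ofNat, im_ofNat, ofReal_im, zero_re] at h1
  linarith [(abs_le.1 hz).1]

/-- The term 1/z decays too slowly to be integrated, so it is replaced by 1/z - 1/(z + 2h) = 2h/(z(z
+ 2h)); the new pole -2h lies outside the strip. -/
theorem regularPart_eq (hR : StripResolvent R h M) {z : ℂ} (hz : |z.re| ≤ h) (hz0 : z ≠ 0) :
    regularPart R h z = (1 / z ^ 2) • R z - (1 / z ^ 2) • R 0 -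
      (2 * (h : ℂ) / (z * (z + 2 * h))) • (R 0 * R 0) := by
  have h1 := add_two_mul_ne_zero hR.pos hz
  have h2 : (1 / z ^ 2) • R z = R 0 * R 0 * R z + (1 / z) • (R 0 * R 0) + (1 / z ^ 2) • R 0 := by
    conv_lhs => rw [hR.eq_quadratic hz]
    rw [smul_add, smul_add, smul_smul, smul_smul, one_div_mul_cancel (pow_ne_zero 2 hz0), one_smul]
    congr 3
    field_simp
  have h3 : 2 * (h : ℂ) / (z * (z + 2 * h)) = 1 / z - 1 / (z + 2 * h) := by
    field_simp
    ring
  rw [h2, h3, sub_smul, regularPart]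
  abel

theorem norm_regularPart_le (hR : StripResolvent R h M) {z : ℂ} (hz : |z.re| ≤ h) :
    ‖regularPart R h z‖ ≤
      2 * (M * M * M + 1 / h * (M * M) + (2 * M + 2 * h * (M * M))) * (1 + z.im ^ 2)⁻¹ := by
  have hM := hR.bound_nonneg
  have hh := hR.pos
  have hR0 := hR.bound 0 hR.zero_mem
  have hRz := hR.bound z hz
  have hRR : ‖R 0 * R 0‖ ≤ M * M := (norm_mul_le _ _).trans (by gcongr)
  have hmul : ∀ {a : ℝ} {A B : X →L[ℂ] X} {b : ℝ}, ‖A‖ ≤ a → ‖B‖ ≤ b → ‖A * B‖ ≤ a * b :=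
    fun hA hB => (norm_mul_le _ _).trans
      (mul_le_mul hA hB (norm_nonneg _) ((norm_nonneg _).trans hA))
  -- Near the real axis the definition of `regularPart`, free of the pole at 0, gives boundedness;
  -- away from it `regularPart_eq` gives decay 1/(Im z)². The factor 2 passes to (1 + (Im z)²)⁻¹ in
  -- both cases.
  rcases le_total (z.im ^ 2) 1 with him | him
  · have h1 : ‖regularPart R h z‖ ≤ M * M * M + 1 / h * (M * M) := by
      refine (norm_add_le _ _).trans (add_le_add (hmul hRR hRz) ?_)
      rw [norm_smul]
      gcongr
      refine norm_one_div_le hh (le_trans ?_ (le_abs_self _))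
      simp only [add_re, mul_re, ofReal_re, re_ofNat, im_ofNat, ofReal_im]
      linarith [(abs_le.1 hz).1]
    have h2 : 0 ≤ M * M * M + 1 / h * (M * M) := by positivity
    have h3 : 0 ≤ 2 * M + 2 * h * (M * M) := by positivity
    rw [← div_eq_mul_inv, le_div_iff₀ (by positivity)]
    nlinarith [norm_nonneg (regularPart R h z), sq_nonneg z.im]
  · have hz0 : z ≠ 0 := fun h0 => by norm_num [h0] at him
    have h1 : |z.im| ≤ ‖z‖ := abs_im_le_norm z
    have h2 : |z.im| ≤ ‖z + 2 * h‖ := by simpa using abs_im_le_norm (z + 2 * h)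
    have him0 : 0 < |z.im| := abs_pos.2 fun h0 => by norm_num [h0] at him
    have h3 : ‖1 / z ^ 2‖ ≤ 1 / z.im ^ 2 := by
      rw [norm_div, norm_one, norm_pow, ← sq_abs z.im]
      gcongr
    have h4 : ‖2 * (h : ℂ) / (z * (z + 2 * h))‖ ≤ 2 * h * (1 / z.im ^ 2) := by
      rw [norm_div, norm_mul, norm_mul, norm_real, Real.norm_of_nonneg hh.le, ← sq_abs z.im,
        pow_two, mul_one_div]
      simp only [norm_ofNat]
      gcongr
    have h5 : ‖regularPart R h z‖ ≤ (2 * M + 2 * h * (M * M)) * (1 / z.im ^ 2) := by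
      rw [hR.regularPart_eq hz hz0]
      have e1 : ‖(1 / z ^ 2) • R z‖ ≤ 1 / z.im ^ 2 * M := by rw [norm_smul]; gcongr
      have e2 : ‖(1 / z ^ 2) • R 0‖ ≤ 1 / z.im ^ 2 * M := by rw [norm_smul]; gcongr
      have e3 : ‖(2 * (h : ℂ) / (z * (z + 2 * h))) • (R 0 * R 0)‖ ≤
          2 * h * (1 / z.im ^ 2) * (M * M) := by rw [norm_smul]; gcongr
      have e4 := norm_sub_le ((1 / z ^ 2) • R z) ((1 / z ^ 2) • R 0)
      refine (norm_sub_le _ _).trans ?_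
      linarith
    have h6 : 1 / z.im ^ 2 ≤ 2 * (1 + z.im ^ 2)⁻¹ := by
      rw [← div_eq_mul_inv, div_le_div_iff₀ (by positivity) (by positivity)]
      linarith
    have h7 : 0 ≤ M * M * M + 1 / h * (M * M) := by positivity
    calc _ ≤ (2 * M + 2 * h * (M * M)) * (2 * (1 + z.im ^ 2)⁻¹) := h5.trans (by gcongr)
      _ = 2 * (0 + (2 * M + 2 * h * (M * M))) * (1 + z.im ^ 2)⁻¹ := by ring
      _ ≤ _ := by gcongr

/-- Substituting t ↦ -t shows that the reflected family produces A₋, an integral of R itself over Re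
= -h. -/
theorem lineIntegral_reflect (R : ℂ → X →L[ℂ] X) (h : ℝ) :
    lineIntegral (Dichotomy.reflect R) h = -((1 / (2 * (Real.pi : ℂ))) •
      ∫ t : ℝ, (1 / (((-h : ℝ) : ℂ) + t * I) ^ 2) • R (((-h : ℝ) : ℂ) + t * I)) := by
  rw [lineIntegral, ← smul_neg, ← integral_neg, ← integral_neg_eq_self]
  congr 2
  funext t
  have h1 : -((h : ℂ) + ((-t : ℝ) : ℂ) * I) = ((-h : ℝ) : ℂ) + t * I := by push_cast; ring
  rw [Dichotomy.reflect, h1, smul_neg, ← h1, neg_sq]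

variable [CompleteSpace X]

theorem integral_regularPart_eq (hR : StripResolvent R h M) :
    ∫ t : ℝ, regularPart R h (((-h : ℝ) : ℂ) + t * I) = ∫ t : ℝ, regularPart R h (h + t * I) := by
  have hh := hR.pos
  refine integral_vertical_eq (by linarith) ?_ ?_ fun z h1 h2 =>
    hR.norm_regularPart_le (abs_le.2 ⟨h1, h2⟩)
  · have hs : {z : ℂ | -h ≤ z.re ∧ z.re ≤ h} ⊆ {z | |z.re| ≤ h} := fun z hz => abs_le.2 hz
    refine (continuousOn_const.mul (hR.continuousOn.mono hs)).add
      (ContinuousOn.fun_smul (f := fun z => 1 / (z + 2 * (h : ℂ)))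
        (continuousOn_const.div (by fun_prop) fun z hz => ?_) continuousOn_const)
    exact add_two_mul_ne_zero hh (hs hz)
  · intro z hz
    have hz' : |z.re| < h := abs_lt.2 hz
    refine DifferentiableAt.differentiableWithinAt ?_
    refine ((differentiableAt_const _).mul (hR.differentiableAt hz')).add
      (DifferentiableAt.fun_smul (c := fun z => 1 / (z + 2 * (h : ℂ)))
        ((differentiableAt_const _).div (by fun_prop) ?_)
        (differentiableAt_const _))
    exact add_two_mul_ne_zero hh hz'.le

theorem integral_regularPart_line (hR : StripResolvent R h M) {a : ℝ} (ha : |a| = h)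
    (hi : Integrable fun t : ℝ => 2 * (h : ℂ) / (((a : ℂ) + t * I) * ((a : ℂ) + t * I + 2 * h)))
    (h0 : ∫ t : ℝ, 1 / ((a : ℂ) + t * I) ^ 2 = 0) :
    ∫ t : ℝ, regularPart R h (a + t * I) =
      (∫ t : ℝ, (1 / ((a : ℂ) + t * I) ^ 2) • R (a + t * I)) -
      (∫ t : ℝ, 2 * (h : ℂ) / (((a : ℂ) + t * I) * ((a : ℂ) + t * I + 2 * h))) • (R 0 * R 0) := by
  have ha0 : a ≠ 0 := fun h0 => by rw [h0, abs_zero] at ha; exact hR.pos.ne ha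
  have hi2 : Integrable fun t : ℝ => 1 / ((a : ℂ) + t * I) ^ 2 := by
    refine (integrable_inv_sq_add_sq hR.pos).mono'
      (continuous_one_div_vertical_sq ha0).aestronglyMeasurable (Eventually.of_forall fun t => ?_)
    rw [norm_one_div_vertical_sq, ← ha, sq_abs]
  have heq : ∀ t : ℝ, regularPart R h (a + t * I) = _ := fun t =>
    hR.regularPart_eq (z := a + t * I) (by simpa using ha.le) (vertical_ne_zero ha0 t)
  simp_rw [heq]
  have hi3 := (hR.integrable_line ha).sub (hi2.smul_const (R 0))
  simp only [Pi.sub_def] at hi3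
  rw [integral_sub hi3 (hi.smul_const _),
    integral_sub (hR.integrable_line ha) (hi2.smul_const _), integral_smul_const,
    integral_smul_const, h0, zero_smul, sub_zero]

theorem lineIntegral_add_reflect (hR : StripResolvent R h M) :
    lineIntegral R h + lineIntegral (Dichotomy.reflect R) h = R 0 * R 0 := by
  have hh := hR.pos
  have hright := hR.integral_regularPart_line (abs_of_pos hh) ?_ (integral_one_div_vertical_sq hh)
  · have hleft := hR.integral_regularPart_line (a := -h) (by rw [abs_neg, abs_of_pos hh]) ?_ ?_
    · rw [integral_right_line_rational hh, zero_smul, sub_zero] at hright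
      rw [integral_left_line_rational hh, hR.integral_regularPart_eq, hright, eq_sub_iff_add_eq,
        neg_smul] at hleft
      rw [lineIntegral_reflect, lineIntegral, ← hleft, ← sub_eq_add_neg, ← smul_sub,
        ← sub_eq_add_neg, sub_sub_cancel, smul_smul, one_div_mul_cancel, one_smul]
      exact mul_ne_zero two_ne_zero (ofReal_ne_zero.2 Real.pi_ne_zero)
    · simp_rw [left_line_rational]
      exact ((integrable_inv_sq_add_sq hh).const_mul _).ofReal
    · rw [← integral_neg_eq_self, ← integral_one_div_vertical_sq hh]
      congr 1
      funext t
      rw [← neg_sq]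
      congr 2
      push_cast
      ring
  · exact integrable_right_line_rational hh

end StripResolvent

end Residue

/-! ### Continuation of R(·)x to a half-plane, and the kernel of A₊ -/

section Continuation

variable {X : Type*} [NormedAddCommGroup X] [NormedSpace ℂ X]

/-- `l ↦ R(l) x` extends holomorphically from the strip to the right half-plane, boundedly on
`Re l ≥ 0`. -/
def HasBoundedExtension (R : ℂ → X →L[ℂ] X) (h : ℝ) (x : X) : Prop :=
  ∃ φ : ℂ → X, DifferentiableOn ℂ φ {z | -h < z.re} ∧
    (∀ l : ℂ, -h < l.re → l.re ≤ h → φ l = R l x) ∧ ∃ C : ℝ, ∀ l : ℂ, 0 ≤ l.re → ‖φ l‖ ≤ C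

namespace StripResolvent

variable {R : ℂ → X →L[ℂ] X} {h M : ℝ}

theorem continuous_cauchy_kernel (hR : StripResolvent R h M) {m : ℂ} (hm : m.re < h) (n : ℕ) :
    Continuous fun t : ℝ => (1 / ((h : ℂ) + t * I) ^ 2 * (1 / ((h : ℂ) + t * I - m) ^ n)) •
      R ((h : ℂ) + t * I) := by
  refine ((continuous_one_div_vertical_sq hR.pos.ne').mul
    (continuous_const.div (by fun_prop) fun t => pow_ne_zero _ fun h0 => ?_)).smul
    (hR.continuous_line (abs_of_pos hR.pos).le)
  have := congrArg re h0
  simp at this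
  linarith

theorem norm_cauchy_kernel_le (hR : StripResolvent R h M) {m : ℂ} {δ : ℝ} (hδ : 0 < δ)
    (hm : m.re + δ ≤ h) (n : ℕ) (t : ℝ) :
    ‖(1 / ((h : ℂ) + t * I) ^ 2 * (1 / ((h : ℂ) + t * I - m) ^ n)) • R ((h : ℂ) + t * I)‖ ≤
      (h ^ 2 + t ^ 2)⁻¹ * ((1 / δ) ^ n * M) := by
  rw [norm_smul, norm_mul, norm_one_div_vertical_sq, ← one_div_pow, norm_pow, mul_assoc]
  gcongr
  · refine norm_one_div_le hδ (le_trans ?_ (le_abs_self _))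
    simp
    linarith
  · exact hR.bound _ (by simp [abs_of_pos hR.pos])

theorem integrable_cauchy_kernel (hR : StripResolvent R h M) {m : ℂ} (hm : m.re < h) (n : ℕ) :
    Integrable fun t : ℝ => (1 / ((h : ℂ) + t * I) ^ 2 * (1 / ((h : ℂ) + t * I - m) ^ n)) •
      R ((h : ℂ) + t * I) :=
  ((integrable_inv_sq_add_sq hR.pos).mul_const _).mono'
    (hR.continuous_cauchy_kernel hm n).aestronglyMeasurable
    (Eventually.of_forall (hR.norm_cauchy_kernel_le (sub_pos.2 hm) (by linarith) n))

theorem differentiableOn_cauchyIntegral [CompleteSpace X] (hR : StripResolvent R h M) :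
    DifferentiableOn ℂ (cauchyIntegral R h) {m | m.re < h} := by
  intro m (hm : m.re < h)
  refine DifferentiableAt.differentiableWithinAt ?_
  refine DifferentiableAt.const_smul ?_ (1 / (2 * (Real.pi : ℂ)))
  -- Half the distance from m to the line: points near m stay at distance δ from it, which dominates
  -- the differentiated kernel uniformly.
  set δ := (h - m.re) / 2 with hδ
  have hδ0 : 0 < δ := by linarith
  have hs : {z : ℂ | z.re < h - δ} ∈ 𝓝 m :=
    (isOpen_lt continuous_re continuous_const).mem_nhds (by
      show m.re < h - δ
      linarith)
  have hlt : ∀ z ∈ {z : ℂ | z.re < h - δ}, z.re < h := fun z hz => by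
    have : z.re < h - δ := hz
    linarith
  have key := hasDerivAt_integral_of_dominated_loc_of_deriv_le (μ := volume) (𝕜 := ℂ)
    (F := fun m (t : ℝ) => (1 / ((h : ℂ) + t * I) ^ 2 * (1 / ((h : ℂ) + t * I - m))) •
      R ((h : ℂ) + t * I))
    (F' := fun m (t : ℝ) => (1 / ((h : ℂ) + t * I) ^ 2 * (1 / ((h : ℂ) + t * I - m) ^ 2)) •
      R ((h : ℂ) + t * I))
    (bound := fun t => (h ^ 2 + t ^ 2)⁻¹ * ((1 / δ) ^ 2 * M)) hs ?_ ?_ ?_ ?_ ?_ ?_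
  · exact key.2.differentiableAt
  · filter_upwards [hs] with z hz
    simpa using (hR.continuous_cauchy_kernel (hlt z hz) 1).aestronglyMeasurable
  · simpa using hR.integrable_cauchy_kernel hm 1
  · exact (hR.continuous_cauchy_kernel hm 2).aestronglyMeasurable
  · refine Eventually.of_forall fun t z hz => hR.norm_cauchy_kernel_le hδ0 ?_ 2 t
    have : z.re < h - δ := hz
    linarith
  · exact (integrable_inv_sq_add_sq hR.pos).mul_const _
  · refine Eventually.of_forall fun t z hz => ?_
    have hne : (h : ℂ) + t * I - z ≠ 0 := fun h0 => by
      have h1 := congrArg re h0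
      simp at h1
      linarith [hlt z hz]
    have h1 : HasDerivAt (fun z : ℂ => 1 / ((h : ℂ) + t * I - z))
        (1 / ((h : ℂ) + t * I - z) ^ 2) z := by
      have := (((hasDerivAt_id z).const_sub ((h : ℂ) + t * I)).fun_inv hne)
      simpa using this
    exact (h1.const_mul (1 / ((h : ℂ) + t * I) ^ 2)).smul_const (R ((h : ℂ) + t * I))

theorem norm_cauchyIntegral_le (hR : StripResolvent R h M) :
    ∃ K, 0 ≤ K ∧ ∀ m : ℂ, m.re ≤ 0 → ‖cauchyIntegral R h m‖ ≤ K := by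
  refine ⟨‖1 / (2 * (Real.pi : ℂ))‖ * ∫ t : ℝ, (h ^ 2 + t ^ 2)⁻¹ * ((1 / h) ^ 1 * M), ?_,
    fun m hm => ?_⟩
  · have := hR.bound_nonneg
    have := hR.pos
    exact mul_nonneg (norm_nonneg _) (integral_nonneg fun t => by positivity)
  · rw [cauchyIntegral, norm_smul]
    gcongr
    refine norm_integral_le_of_norm_le ((integrable_inv_sq_add_sq hR.pos).mul_const _)
      (Eventually.of_forall fun t => ?_)
    simpa using hR.norm_cauchy_kernel_le hR.pos (show m.re + h ≤ h by linarith) 1 t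

variable [CompleteSpace X]

theorem mul_lineIntegral (hR : StripResolvent R h M) (T : X →L[ℂ] X) :
    T * lineIntegral R h = (1 / (2 * (Real.pi : ℂ))) •
      ∫ t : ℝ, (1 / ((h : ℂ) + t * I) ^ 2) • (T * R ((h : ℂ) + t * I)) := by
  rw [lineIntegral, mul_smul_comm]
  congr 1
  have := (ContinuousLinearMap.mul ℂ (X →L[ℂ] X) T).integral_comp_comm
    (hR.integrable_line (abs_of_pos hR.pos))
  simp only [ContinuousLinearMap.mul_apply', mul_smul_comm] at this
  exact this.symm

theorem lineIntegral_mul (hR : StripResolvent R h M) (T : X →L[ℂ] X) :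
    lineIntegral R h * T = (1 / (2 * (Real.pi : ℂ))) •
      ∫ t : ℝ, (1 / ((h : ℂ) + t * I) ^ 2) • (R ((h : ℂ) + t * I) * T) := by
  rw [lineIntegral, smul_mul_assoc]
  congr 1
  have := ((ContinuousLinearMap.mul ℂ (X →L[ℂ] X)).flip T).integral_comp_comm
    (hR.integrable_line (abs_of_pos hR.pos))
  simp only [ContinuousLinearMap.flip_apply, ContinuousLinearMap.mul_apply',
    smul_mul_assoc] at this
  exact this.symm

theorem lineIntegral_commute (hR : StripResolvent R h M) {l : ℂ} (hl : |l.re| ≤ h) :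
    lineIntegral R h * R l = R l * lineIntegral R h := by
  rw [hR.lineIntegral_mul, hR.mul_lineIntegral]
  congr 2
  funext t
  rw [hR.mul_comm (by simp [abs_of_pos hR.pos]) hl]

/-- The resolvent identity splits R(m)R(λ) into (R(λ) - R(m))/(λ - m). The R(m) term integrates to 0
because the poles 0 and m both lie left of the line. The Cauchy integral thus continues R(m)A₊ to
the whole half-plane Re m < h. -/
theorem cauchyIntegral_eq (hR : StripResolvent R h M) {m : ℂ} (hm : -h ≤ m.re) (hm' : m.re < h) :
    cauchyIntegral R h m = R m * lineIntegral R h := by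
  have habs : |m.re| ≤ h := abs_le.2 ⟨hm, hm'.le⟩
  rw [hR.mul_lineIntegral, cauchyIntegral]
  congr 1
  have hi : Integrable fun t : ℝ => (1 / ((h : ℂ) + t * I) ^ 2 * (1 / ((h : ℂ) + t * I - m))) •
      R ((h : ℂ) + t * I) := by simpa using hR.integrable_cauchy_kernel hm' 1
  have heq : ∀ t : ℝ, (1 / ((h : ℂ) + t * I) ^ 2) • (R m * R ((h : ℂ) + t * I)) =
      (1 / ((h : ℂ) + t * I) ^ 2 * (1 / ((h : ℂ) + t * I - m))) • R ((h : ℂ) + t * I) -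
      (1 / ((h : ℂ) + t * I) ^ 2 * (1 / ((h : ℂ) + t * I - m))) • R m := fun t => by
    have hz : |((h : ℂ) + t * I).re| ≤ h := by simp [abs_of_pos hR.pos]
    have hne : (h : ℂ) + t * I - m ≠ 0 := fun h0 => by
      have h1 := congrArg re h0
      simp at h1
      linarith
    rw [← smul_sub, hR.identity _ m hz habs, smul_smul, mul_assoc, one_div_mul_cancel hne,
      mul_one, hR.mul_comm hz habs]
  have hi2 : Integrable fun t : ℝ => 1 / ((h : ℂ) + t * I) ^ 2 * (1 / ((h : ℂ) + t * I - m)) := by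
    refine ((integrable_inv_sq_add_sq hR.pos).mul_const (1 / (h - m.re))).mono'
      (Continuous.aestronglyMeasurable ?_) (Eventually.of_forall fun t => ?_)
    · refine (continuous_one_div_vertical_sq hR.pos.ne').mul
        (continuous_const.div (by fun_prop) fun t h0 => ?_)
      have h1 := congrArg re h0
      simp at h1
      linarith
    · rw [norm_mul, norm_one_div_vertical_sq]
      gcongr
      exact norm_one_div_le (sub_pos.2 hm') (le_trans (by simp) (le_abs_self _))
  simp_rw [heq]
  rw [integral_sub hi (hi2.smul_const _), integral_smul_const,
    integral_one_div_vertical_sq_mul hR.pos hm', zero_smul, sub_zero]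

theorem differentiableOn_continuation (hR : StripResolvent R h M) :
    DifferentiableOn ℂ (continuation R h) {z | -h < z.re} := by
  have h1 : DifferentiableOn ℂ (fun l => cauchyIntegral (Dichotomy.reflect R) h (-l))
      {z | -h < z.re} :=
    hR.reflect.differentiableOn_cauchyIntegral.comp (by fun_prop) fun z hz => by
      have : -h < z.re := hz
      show (-z).re < h
      rw [neg_re]
      linarith
  exact ((DifferentiableOn.fun_smul (by fun_prop) h1.neg).add
    (DifferentiableOn.fun_smul (by fun_prop) (by fun_prop))).add (by fun_prop)

theorem continuation_apply (hR : StripResolvent R h M) {x : X} (hx : lineIntegral R h x = 0)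
    {l : ℂ} (hl : -h < l.re) (hl' : l.re ≤ h) : continuation R h l x = R l x := by
  have habs : |l.re| ≤ h := abs_le.2 ⟨hl.le, hl'⟩
  -- As A₊x = 0, the residue identity reduces to A₋x = R(0)²x.
  have h1 : lineIntegral (Dichotomy.reflect R) h x = R 0 (R 0 x) := by
    have := DFunLike.congr_fun hR.lineIntegral_add_reflect x
    simpa [hx] using this
  have h2 : cauchyIntegral (Dichotomy.reflect R) h (-l) x = -R l (R 0 (R 0 x)) := by
    rw [hR.reflect.cauchyIntegral_eq (by simpa using hl') (by simpa using neg_lt.1 hl)]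
    simp [Dichotomy.reflect, h1]
  have h3 : R l (R 0 (R 0 x)) = R 0 (R 0 (R l x)) := by
    have hc := fun y => DFunLike.congr_fun (hR.mul_comm habs hR.zero_mem) y
    simp only [mul_apply_eq_comp] at hc
    rw [hc, hc]
  have h4 := DFunLike.congr_fun (hR.eq_quadratic habs) x
  rw [h4]
  simp [continuation, h2, h3]

/-- The defining formula yields only quadratic growth; on the imaginary axis the continuation is
R(l)x, so Phragmén–Lindelöf carries the bound M‖x‖ to the half-plane. -/
theorem norm_continuation_apply_le (hR : StripResolvent R h M) {x : X}
    (hx : lineIntegral R h x = 0) {l : ℂ} (hl : 0 ≤ l.re) :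
    ‖continuation R h l x‖ ≤ M * ‖x‖ := by
  obtain ⟨K, hK0, hK⟩ := hR.reflect.norm_cauchyIntegral_le
  have hM := hR.bound_nonneg
  have hpos := hR.pos
  have hR0 := hR.bound 0 hR.zero_mem
  have hd : DifferentiableOn ℂ (fun l => continuation R h l x) {z | -h < z.re} :=
    hR.differentiableOn_continuation.clm_apply (differentiableOn_const _)
  have hcl : closure {z : ℂ | 0 < z.re} ⊆ {z | -h < z.re} :=
    fun z hz => (neg_lt_zero.2 hpos).trans_le (closure_minimal (t := {z : ℂ | 0 ≤ z.re})
      (fun z (hz : 0 < z.re) => hz.le) (isClosed_le continuous_const continuous_re) hz)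
  refine norm_le_of_quadratic_growth (f := fun l => continuation R h l x)
    (K := (K + M * M + M) * ‖x‖) (hd.mono hcl).diffContOnCl (fun z hz => ?_) (fun z hz => ?_) hl
  · have h1 : ‖continuation R h z‖ ≤ (K + M * M + M) * (1 + ‖z‖) ^ 2 := by
      have e1 : ‖z ^ 2 • (-cauchyIntegral (Dichotomy.reflect R) h (-z))‖ ≤ ‖z‖ ^ 2 * K := by
        rw [norm_smul, norm_pow, norm_neg]
        gcongr
        exact hK _ (by simpa using hz)
      have e2 : ‖z • (R 0 * R 0)‖ ≤ ‖z‖ * (M * M) := by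
        rw [norm_smul]
        gcongr
        exact (norm_mul_le _ _).trans (by gcongr)
      have e3 := norm_add₃_le (a := z ^ 2 • (-cauchyIntegral (Dichotomy.reflect R) h (-z)))
        (b := z • (R 0 * R 0)) (c := R 0)
      have hz0 := norm_nonneg z
      have e4 : ‖z‖ ^ 2 * K + ‖z‖ * (M * M) + M ≤ (K + M * M + M) * (1 + ‖z‖) ^ 2 := by
        have : 0 ≤ M * M := by positivity
        nlinarith [mul_nonneg hz0 hK0, mul_nonneg hz0 hM, mul_nonneg hz0 this,
          mul_nonneg (sq_nonneg ‖z‖) hM, mul_nonneg (sq_nonneg ‖z‖) this]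
      rw [continuation]
      linarith
    calc _ ≤ ‖continuation R h z‖ * ‖x‖ := ContinuousLinearMap.le_opNorm _ _
      _ ≤ (K + M * M + M) * (1 + ‖z‖) ^ 2 * ‖x‖ := by gcongr
      _ = _ := by ring
  · have h1 := hR.continuation_apply hx (l := z) (by linarith) (by linarith)
    simp only [h1]
    refine (ContinuousLinearMap.le_opNorm _ _).trans ?_
    gcongr
    exact hR.bound z (by simpa [hz] using hpos.le)

theorem hasBoundedExtension_iff (hR : StripResolvent R h M) {x : X} :
    HasBoundedExtension R h x ↔ lineIntegral R h x = 0 := by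
  have hpos := hR.pos
  constructor
  · rintro ⟨φ, hφ, hφR, C, hC⟩
    have h1 : lineIntegral R h x = (1 / (2 * (Real.pi : ℂ))) •
        ∫ t : ℝ, (1 / ((h : ℂ) + t * I) ^ 2) • φ ((h : ℂ) + t * I) := by
      rw [lineIntegral, smul_apply,
        ContinuousLinearMap.integral_apply (hR.integrable_line (abs_of_pos hpos))]
      congr 2
      funext t
      rw [smul_apply, hφR _ (by simp; linarith) (by simp)]
    have hsub : ∀ z : ℂ, h ≤ z.re → -h < z.re := fun z hz => by linarith
    have hne : ∀ z : ℂ, h ≤ z.re → z ^ 2 ≠ 0 := fun z hz =>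
      pow_ne_zero _ fun h0 => by rw [h0, zero_re] at hz; linarith
    rw [h1, integral_vertical_eq_zero (f := fun z => (1 / z ^ 2) • φ z) (C := C) hpos, smul_zero]
    · exact (continuousOn_const.div (by fun_prop) hne).smul (hφ.continuousOn.mono hsub)
    · exact ((differentiableOn_const _).div (by fun_prop) fun z hz => hne z (le_of_lt hz)).smul
        (hφ.mono fun z hz => hsub z (le_of_lt hz))
    · intro z hz
      rw [norm_smul, norm_div, norm_one, norm_pow, one_div_mul_eq_div]
      gcongr
      exact hC z (hpos.le.trans hz)
  · intro hx
    exact ⟨fun l => continuation R h l x,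
      hR.differentiableOn_continuation.clm_apply (differentiableOn_const _),
      fun l hl hl' => hR.continuation_apply hx hl hl', M * ‖x‖,
      fun l hl => hR.norm_continuation_apply_le hx hl⟩

/-- The reflected Cauchy integral is a bounded extension of R(·)A₋x to the right half-plane, so A₋x
lies in the kernel of A₊. -/
theorem lineIntegral_mul_reflect (hR : StripResolvent R h M) :
    lineIntegral R h * lineIntegral (Dichotomy.reflect R) h = 0 := by
  ext x
  refine hR.hasBoundedExtension_iff.1 ?_
  obtain ⟨K, -, hK⟩ := hR.reflect.norm_cauchyIntegral_le
  refine ⟨fun l => -cauchyIntegral (Dichotomy.reflect R) h (-l) x, ?_, fun l hl hl' => ?_,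
    K * ‖x‖, fun l hl => ?_⟩
  · have h1 : DifferentiableOn ℂ (fun l => cauchyIntegral (Dichotomy.reflect R) h (-l))
        {z | -h < z.re} :=
      hR.reflect.differentiableOn_cauchyIntegral.comp (by fun_prop) fun z hz => by
        have : -h < z.re := hz
        show (-z).re < h
        rw [neg_re]
        linarith
    exact (h1.clm_apply (differentiableOn_const _)).neg
  · simp only
    rw [hR.reflect.cauchyIntegral_eq (by simpa using hl') (by simpa using neg_lt.1 hl)]
    simp [Dichotomy.reflect]
  · rw [norm_neg]
    exact (ContinuousLinearMap.le_opNorm _ _).trans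
      (mul_le_mul_of_nonneg_right (hK _ (by simpa using hl)) (norm_nonneg _))

/-- The continuation satisfies the resolvent equation. -/
theorem resolvent_equation_of_eqOn (hR : StripResolvent R h M) {φ : ℂ → X} {x : X}
    (hφ : DifferentiableOn ℂ φ {z | -h < z.re})
    (hφR : ∀ l : ℂ, -h < l.re → l.re ≤ h → φ l = R l x) {l : ℂ} (hl : -h < l.re) :
    φ l = R 0 (x + l • φ l) := by
  refine eqOn_halfPlane_of_eqOn_strip hR.pos hφ
    (g := fun l => R 0 (x + l • φ l)) ?_ (fun z hz => ?_) hl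
  · exact (R 0).differentiable.comp_differentiableOn
      ((differentiableOn_const _).add (differentiableOn_id.smul hφ))
  · have h1 := DFunLike.congr_fun (hR.eq_add_smul hz.le) x
    rw [hφR z (abs_lt.1 hz).1 (abs_lt.1 hz).2.le]
    conv_lhs => rw [h1]
    simp

theorem continuation_resolvent_equation (hR : StripResolvent R h M) {x : X}
    (hx : lineIntegral R h x = 0) {l : ℂ} (hl : -h < l.re) :
    continuation R h l x = R 0 (x + l • continuation R h l x) :=
  hR.resolvent_equation_of_eqOn (φ := fun l => continuation R h l x)
    (hR.differentiableOn_continuation.clm_apply (differentiableOn_const _))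
    (fun _ hl hl' => hR.continuation_apply hx hl hl') hl

theorem lineIntegral_continuation (hR : StripResolvent R h M) {x : X}
    (hx : lineIntegral R h x = 0) {l : ℂ} (hl : -h < l.re) :
    lineIntegral R h (continuation R h l x) = 0 := by
  refine eqOn_halfPlane_of_eqOn_strip hR.pos
    (f := fun l => lineIntegral R h (continuation R h l x)) (g := fun _ => 0)
    ((lineIntegral R h).differentiable.comp_differentiableOn
      (hR.differentiableOn_continuation.clm_apply (differentiableOn_const _)))
    (differentiableOn_const _) (fun z hz => ?_) hl
  have h1 := DFunLike.congr_fun (hR.lineIntegral_commute hz.le) x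
  simp only [mul_apply_eq_comp, hx, map_zero] at h1
  rw [hR.continuation_apply hx (abs_lt.1 hz).1 (abs_lt.1 hz).2.le, h1]

theorem lineIntegral_resolvent_zero (hR : StripResolvent R h M) {x : X} :
    lineIntegral R h (R 0 x) = 0 ↔ lineIntegral R h x = 0 := by
  have h1 := DFunLike.congr_fun (hR.lineIntegral_commute hR.zero_mem) x
  simp only [mul_apply_eq_comp] at h1
  rw [h1]
  exact ⟨fun h => hR.eq_zero _ h, fun h => by rw [h, map_zero]⟩

theorem continuation_resolvent_zero (hR : StripResolvent R h M) {x : X}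
    (hx : lineIntegral R h x = 0) {l : ℂ} (hl : -h < l.re) :
    continuation R h l (R 0 x) = R 0 (continuation R h l x) := by
  refine eqOn_halfPlane_of_eqOn_strip hR.pos
    (f := fun l => continuation R h l (R 0 x)) (g := fun l => R 0 (continuation R h l x))
    (hR.differentiableOn_continuation.clm_apply (differentiableOn_const _))
    ((R 0).differentiable.comp_differentiableOn
      (hR.differentiableOn_continuation.clm_apply (differentiableOn_const _))) (fun z hz => ?_) hl
  have h1 := DFunLike.congr_fun (hR.mul_comm hz.le hR.zero_mem) x
  simp only [mul_apply_eq_comp] at h1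
  rw [hR.continuation_apply hx (abs_lt.1 hz).1 (abs_lt.1 hz).2.le,
    hR.continuation_apply (hR.lineIntegral_resolvent_zero.2 hx) (abs_lt.1 hz).1
      (abs_lt.1 hz).2.le, h1]

end StripResolvent

end Continuation

/-! ### Resolvents of unbounded operators -/

section Resolvent

variable {X : Type*} [NormedAddCommGroup X] [NormedSpace ℂ X] {S : X →ₗ.[ℂ] X} {l m : ℂ}
  {R R' : X →L[ℂ] X}

theorem IsResolvent.apply_eq (hR : IsResolvent S l R) {x y : X} (hx : x ∈ S.domain)
    (hxy : S ⟨x, hx⟩ - l • x = y) : R y = x := by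
  rw [← hxy]
  exact hR.2 ⟨x, hx⟩

theorem IsResolvent.unique (hR : IsResolvent S l R) (hR' : IsResolvent S l R') : R = R' := by
  ext y
  obtain ⟨hy, h⟩ := hR'.1 y
  exact hR.apply_eq hy h

theorem isResolvent_resolv (hl : l ∈ rho S) : IsResolvent S l (resolv S l) := by
  rw [resolv, dif_pos hl]
  exact hl.choose_spec

theorem IsResolvent.mem_rho (hR : IsResolvent S l R) : l ∈ rho S := ⟨R, hR⟩

theorem IsResolvent.resolv_eq (hR : IsResolvent S l R) : resolv S l = R :=
  (isResolvent_resolv hR.mem_rho).unique hR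

theorem resolv_of_notMem (hl : l ∉ rho S) : resolv S l = 0 := dif_neg hl

theorem IsResolvent.sub_eq (hR : IsResolvent S l R) (hR' : IsResolvent S m R') :
    R - R' = (l - m) • (R * R') := by
  ext y
  obtain ⟨hy, h⟩ := hR'.1 y
  have h1 : R y = R' y + (l - m) • R (R' y) := by
    have h2 := hR.apply_eq hy rfl
    have h3 : y = (S ⟨R' y, hy⟩ - l • R' y) + (l - m) • R' y := by
      rw [sub_smul, ← add_sub_assoc, sub_add_cancel, h]
    conv_lhs => rw [h3]
    rw [map_add, map_smul, h2]
  rw [sub_apply, h1]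
  simp

/-- The Neumann series for the resolvent. -/
theorem IsResolvent.mul_inverse [CompleteSpace X] (hR : IsResolvent S l R)
    (hm : ‖(m - l) • R‖ < 1) :
    IsResolvent S m (R * Ring.inverse (1 - (m - l) • R)) := by
  have hu : IsUnit (1 - (m - l) • R) := isUnit_one_sub_of_norm_lt_one hm
  have h1 : ∀ y, (1 - (m - l) • R) (Ring.inverse (1 - (m - l) • R) y) = y := fun y => by
    have := DFunLike.congr_fun (Ring.mul_inverse_cancel _ hu) y
    simpa only [mul_apply_eq_comp, one_apply_eq_self] using this
  have h2 : ∀ y, Ring.inverse (1 - (m - l) • R) ((1 - (m - l) • R) y) = y := fun y => by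
    have := DFunLike.congr_fun (Ring.inverse_mul_cancel _ hu) y
    simpa only [mul_apply_eq_comp, one_apply_eq_self] using this
  have key : ∀ (u : X) (hu : R u ∈ S.domain), S ⟨R u, hu⟩ - l • R u = u →
      S ⟨R u, hu⟩ - m • R u = (1 - (m - l) • R) u := fun u hu h => by
    simp only [sub_apply, smul_apply, one_apply_eq_self, sub_smul]
    nth_rw 3 [← h]
    abel
  refine ⟨fun y => ?_, fun x => ?_⟩
  · obtain ⟨hy, h⟩ := hR.1 (Ring.inverse (1 - (m - l) • R) y)
    exact ⟨hy, (key _ hy h).trans (h1 y)⟩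
  · have h3 := hR.2 x
    have h4 : S x - m • (x : X) = (1 - (m - l) • R) (S x - l • (x : X)) := by
      simp only [sub_apply, smul_apply, one_apply_eq_self, h3, sub_smul]
      abel
    rw [h4, mul_apply_eq_comp, h2, h3]

theorem eventually_norm_smul_lt_one (R : X →L[ℂ] X) (l : ℂ) :
    ∀ᶠ m in 𝓝 l, ‖(m - l) • R‖ < 1 := by
  have h1 : ContinuousAt (fun m : ℂ => ‖(m - l) • R‖) l := by fun_prop
  exact h1.eventually_lt continuousAt_const (by simp)

theorem isOpen_rho [CompleteSpace X] (S : X →ₗ.[ℂ] X) : IsOpen (rho S) :=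
  isOpen_iff_mem_nhds.2 fun l ⟨R, hR⟩ =>
    (eventually_norm_smul_lt_one R l).mono fun _ hm => (hR.mul_inverse hm).mem_rho

theorem analyticOnNhd_resolv [CompleteSpace X] (S : X →ₗ.[ℂ] X) :
    AnalyticOnNhd ℂ (resolv S) (rho S) := by
  refine DifferentiableOn.analyticOnNhd (fun l hl => ?_) (isOpen_rho S)
  obtain ⟨R, hR⟩ := hl
  refine DifferentiableAt.differentiableWithinAt ?_
  have h1 : (fun m => R * Ring.inverse (1 - (m - l) • R)) =ᶠ[𝓝 l] resolv S :=
    (eventually_norm_smul_lt_one R l).mono fun m hm => ((hR.mul_inverse hm).resolv_eq).symm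
  refine DifferentiableAt.congr_of_eventuallyEq ?_ h1.symm
  refine (differentiableAt_const _).mul ?_
  have h2 : DifferentiableAt ℂ (Ring.inverse : (X →L[ℂ] X) → _) (1 - (l - l) • R) := by
    rw [sub_self, zero_smul, sub_zero]
    exact differentiableAt_inverse (x := (1 : X →L[ℂ] X)) isUnit_one
  exact DifferentiableAt.fun_comp' (f := fun m : ℂ => 1 - (m - l) • R) l h2 (by fun_prop)

theorem analyticOnNhd_resolv_apply [CompleteSpace X] (S : X →ₗ.[ℂ] X) (x : X) :
    AnalyticOnNhd ℂ (fun l => resolv S l x) (rho S) :=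
  ((analyticOnNhd_resolv S).differentiableOn.clm_apply
    (differentiableOn_const _)).analyticOnNhd (isOpen_rho S)

theorem stripResolvent_resolv {h M : ℝ} (hpos : 0 < h) (hstrip : ∀ l : ℂ, |l.re| ≤ h → l ∈ rho S)
    (hM : ∀ l : ℂ, |l.re| ≤ h → ‖resolv S l‖ ≤ M) : StripResolvent (resolv S) h M where
  pos := hpos
  identity l m hl hm :=
    (isResolvent_resolv (hstrip l hl)).sub_eq (isResolvent_resolv (hstrip m hm))
  bound := hM
  eq_zero x hx := by
    obtain ⟨hy, h⟩ := (isResolvent_resolv (hstrip 0 (by simpa using hpos.le))).1 x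
    have h0 : (⟨resolv S 0 x, hy⟩ : S.domain) = 0 := Subtype.ext hx
    rw [← h, h0, hx, S.map_zero, smul_zero, sub_zero]

/-! ### Passage from S to -S -/

section Neg

theorem IsResolvent.neg (hR : IsResolvent S l R) : IsResolvent (-S) (-l) (-R) := by
  refine ⟨fun y => ?_, fun x => ?_⟩
  · obtain ⟨hy, h⟩ := hR.1 y
    have hy' : (-R) y ∈ (-S).domain := S.domain.neg_mem hy
    refine ⟨hy', ?_⟩
    have h1 : (-S) ⟨(-R) y, hy'⟩ = S ⟨R y, hy⟩ := by
      rw [LinearPMap.neg_apply, ← S.map_neg]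
      congr 1
      exact Subtype.ext (by simp)
    rw [h1]
    simpa using h
  · have h1 := hR.2 x
    rw [LinearPMap.neg_apply, neg_apply, ← map_neg]
    refine Eq.trans ?_ h1
    congr 1
    rw [neg_smul]
    abel

theorem neg_mem_rho_neg (hl : l ∈ rho S) : -l ∈ rho (-S) := by
  obtain ⟨R, hR⟩ := hl
  exact hR.neg.mem_rho

theorem mem_rho_neg_iff : l ∈ rho (-S) ↔ -l ∈ rho S :=
  ⟨fun h => by simpa using neg_mem_rho_neg h, fun h => by simpa using neg_mem_rho_neg h⟩

theorem resolv_neg (S : X →ₗ.[ℂ] X) : resolv (-S) = reflect (resolv S) := by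
  funext l
  by_cases hl : -l ∈ rho S
  · have := (isResolvent_resolv hl).neg
    rw [neg_neg] at this
    exact this.resolv_eq
  · rw [resolv_of_notMem fun h => hl (mem_rho_neg_iff.1 h), reflect, resolv_of_notMem hl, neg_zero]

theorem mem_extSubspace_neg {U V : Set ℂ} (hUV : ∀ l ∈ V, -l ∈ U) {x : X}
    (hx : x ∈ extSubspace S U) : x ∈ extSubspace (-S) V := by
  obtain ⟨φ, hφ, hφR, C, hC⟩ := hx
  refine ⟨fun l => -φ (-l), fun l hl => ?_, fun l hl => ?_, C, fun l hl => ?_⟩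
  · have h1 : -l ∈ U ∪ rho S := hl.imp (hUV l) mem_rho_neg_iff.1
    exact ((hφ _ h1).comp (f := fun l : ℂ => -l) analyticAt_id.neg).neg
  · simp only
    rw [resolv_neg, hφR _ (mem_rho_neg_iff.1 hl)]
    rfl
  · rw [norm_neg]
    exact hC _ (hUV l hl)

theorem Gplus_eq_Gminus_neg (S : X →ₗ.[ℂ] X) : Gplus S = Gminus (-S) := by
  refine le_antisymm (fun x hx => mem_extSubspace_neg (fun l hl => ?_) hx) fun x hx => ?_
  · have : 0 ≤ l.re := hl
    show (-l).re ≤ 0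
    simpa using this
  · have := mem_extSubspace_neg (V := {l | l.re ≤ 0}) (fun l hl => ?_) hx
    · rwa [neg_neg] at this
    · have : l.re ≤ 0 := hl
      show 0 ≤ (-l).re
      simpa using this

theorem Invariant.neg {Y : Submodule ℂ X} (hY : Invariant S Y) : Invariant (-S) Y := fun x hx =>
  Y.neg_mem (hY x hx)

theorem invariant_neg_iff {Y : Submodule ℂ X} : Invariant (-S) Y ↔ Invariant S Y :=
  ⟨fun h => by simpa using h.neg, Invariant.neg⟩

theorem restr_neg {Y : Submodule ℂ X} (hY : Invariant S Y) :
    restr (-S) Y hY.neg = -restr S Y hY :=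
  LinearPMap.ext rfl fun _ _ _ => Subtype.ext rfl

end Neg

end Resolvent

/-! ### The subspaces G₊ and G₋, and strict dichotomy -/

section Subspaces

variable {X : Type*} [NormedAddCommGroup X] [NormedSpace ℂ X] {S : X →ₗ.[ℂ] X} {h M : ℝ}

theorem Aplus_eq_lineIntegral (S : X →ₗ.[ℂ] X) (h : ℝ) :
    Aplus S h = lineIntegral (resolv S) h := by
  simp only [Aplus, lineIntegral, mul_smul]
  rw [integral_smul, smul_smul]
  congr 1
  have := I_ne_zero
  have : (Real.pi : ℂ) ≠ 0 := ofReal_ne_zero.2 Real.pi_ne_zero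
  field_simp

/-- A point of the domain of `S` is recovered from the resolvent at `0`. -/
theorem IsResolvent.zero_apply {R : X →L[ℂ] X} (hR : IsResolvent S 0 R) (x : S.domain) :
    R (S x) = x := by
  simpa using hR.2 x

theorem IsResolvent.zero_mem_domain {R : X →L[ℂ] X} (hR : IsResolvent S 0 R) (y : X) :
    ∃ hy : R y ∈ S.domain, S ⟨R y, hy⟩ = y := by
  simpa using hR.1 y

section Square

theorem mem_sq_domain {R : X →L[ℂ] X} (hR : IsResolvent S 0 R) (y : X) :
    R (R y) ∈ (sq S).domain := by
  obtain ⟨hy, hy'⟩ := hR.zero_mem_domain (R y)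
  obtain ⟨hz, -⟩ := hR.zero_mem_domain y
  refine ⟨⟨⟨R (R y), hy⟩, ?_, rfl⟩, hy⟩
  show S ⟨R (R y), hy⟩ ∈ S.domain
  rwa [hy']

theorem resolvent_resolvent_sq {R : X →L[ℂ] X} (hR : IsResolvent S 0 R) (x : (sq S).domain) :
    R (R (sq S x)) = x := by
  have h1 : R (sq S x) = S ⟨x, x.2.2⟩ := hR.zero_apply ⟨S ⟨x, x.2.2⟩, _⟩
  rw [h1]
  exact hR.zero_apply ⟨x, x.2.2⟩

end Square

section Extension

theorem mem_rho_neg_of_strip (hstrip : ∀ l : ℂ, |l.re| ≤ h → l ∈ rho S) (l : ℂ)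
    (hl : |l.re| ≤ h) : l ∈ rho (-S) :=
  mem_rho_neg_iff.2 (hstrip _ (by simpa using hl))

theorem StripResolvent.resolv_neg (hR : StripResolvent (resolv S) h M) :
    StripResolvent (resolv (-S)) h M := by
  rw [Dichotomy.resolv_neg]
  exact hR.reflect

variable [CompleteSpace X]

theorem mem_Gminus_iff_hasBoundedExtension (hstrip : ∀ l : ℂ, |l.re| ≤ h → l ∈ rho S)
    (hR : StripResolvent (resolv S) h M) {x : X} :
    x ∈ Gminus S ↔ HasBoundedExtension (resolv S) h x := by
  constructor
  · rintro ⟨φ, hφ, hφR, C, hC⟩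
    refine ⟨φ, (hφ.mono fun l (hl : -h < l.re) => ?_).differentiableOn,
      fun l hl hl' => hφR l (hstrip l (abs_le.2 ⟨hl.le, hl'⟩)), C, hC⟩
    rcases le_total 0 l.re with h0 | h0
    · exact Or.inl h0
    · exact Or.inr (hstrip l (abs_le.2 ⟨hl.le, h0.trans hR.pos.le⟩))
  · rintro ⟨φ, hφ, hφR, C, hC⟩
    -- `rho S` may have components that miss the strip, where the identity theorem does not compare
    -- φ with the resolvent. Instead φ(l) = R(0)(x + lφ(l)) shows that φ(l) lies in the domain and
    -- (S - l)φ(l) = x.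
    have hagree : ∀ l ∈ rho S, -h < l.re → φ l = resolv S l x := fun l hl hl' => by
      have h1 := hR.resolvent_equation_of_eqOn hφ hφR hl'
      obtain ⟨hd, hS⟩ := (isResolvent_resolv (hstrip 0 hR.zero_mem)).zero_mem_domain (x + l • φ l)
      have h2 := (isResolvent_resolv hl).apply_eq hd rfl
      rw [hS, ← h1, add_sub_cancel_right] at h2
      exact h2.symm
    classical
    refine ⟨fun l => if -h < l.re then φ l else resolv S l x, fun l hl => ?_, fun l hl => ?_, C,
      fun l (hl : 0 ≤ l.re) => ?_⟩
    · by_cases hlh : -h < l.re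
      · refine (hφ.analyticOnNhd (isOpen_lt_re _) l hlh).congr ?_
        filter_upwards [(isOpen_lt_re (-h)).mem_nhds hlh] with z hz
        exact (if_pos hz).symm
      · have hl' : l ∈ rho S := hl.resolve_left fun (h0 : 0 ≤ l.re) => hlh (by linarith [hR.pos])
        refine (analyticOnNhd_resolv_apply S x l hl').congr ?_
        filter_upwards [(isOpen_rho S).mem_nhds hl'] with z hz
        split_ifs with hz'
        · exact (hagree z hz hz').symm
        · rfl
    · simp only
      split_ifs with hl'
      · exact hagree l hl hl'
      · rfl
    · have hl' : -h < l.re := by linarith [hR.pos]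
      simp only [if_pos hl']
      exact hC l hl

theorem mem_Gminus_iff (hstrip : ∀ l : ℂ, |l.re| ≤ h → l ∈ rho S)
    (hR : StripResolvent (resolv S) h M) {x : X} :
    x ∈ Gminus S ↔ lineIntegral (resolv S) h x = 0 :=
  (mem_Gminus_iff_hasBoundedExtension hstrip hR).trans hR.hasBoundedExtension_iff

theorem mem_Gplus_iff (hstrip : ∀ l : ℂ, |l.re| ≤ h → l ∈ rho S)
    (hR : StripResolvent (resolv S) h M) {x : X} :
    x ∈ Gplus S ↔ lineIntegral (reflect (resolv S)) h x = 0 := by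
  rw [Gplus_eq_Gminus_neg, mem_Gminus_iff (mem_rho_neg_of_strip hstrip) hR.resolv_neg, resolv_neg]

theorem isClosed_Gminus (hstrip : ∀ l : ℂ, |l.re| ≤ h → l ∈ rho S)
    (hR : StripResolvent (resolv S) h M) : IsClosed (Gminus S : Set X) := by
  have : (Gminus S : Set X) = {x | lineIntegral (resolv S) h x = 0} :=
    Set.ext fun x => mem_Gminus_iff hstrip hR
  rw [this]
  exact isClosed_eq (lineIntegral (resolv S) h).continuous continuous_const

theorem disjoint_Gplus_Gminus (hstrip : ∀ l : ℂ, |l.re| ≤ h → l ∈ rho S)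
    (hR : StripResolvent (resolv S) h M) : Disjoint (Gplus S) (Gminus S) := by
  refine Submodule.disjoint_def.2 fun x hp hm => ?_
  have h1 := DFunLike.congr_fun hR.lineIntegral_add_reflect x
  rw [add_apply, (mem_Gplus_iff hstrip hR).1 hp, (mem_Gminus_iff hstrip hR).1 hm, add_zero] at h1
  exact hR.eq_zero _ (hR.eq_zero _ h1.symm)

end Extension

/-- One half of strict dichotomy: `Y` is closed and invariant, the spectrum of `S|Y` lies in the
open left half-plane and its resolvent is bounded on the closed right half-plane. -/
structure IsStableOn (S : X →ₗ.[ℂ] X) (Y : Submodule ℂ X) : Prop where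
  closed : IsClosed (Y : Set X)
  inv : Invariant S Y
  spec_subset : spec (restr S Y inv) ⊆ {l | l.re < 0}
  bound : ∃ M : ℝ, ∀ l : ℂ, 0 ≤ l.re → ‖resolv (restr S Y inv) l‖ ≤ M

theorem isStableOn_neg_iff {Y : Submodule ℂ X} (hY : Invariant S Y) :
    IsStableOn (-S) Y ↔ IsClosed (Y : Set X) ∧ spec (restr S Y hY) ⊆ {l | 0 < l.re} ∧
      ∃ M : ℝ, ∀ l : ℂ, l.re ≤ 0 → ‖resolv (restr S Y hY) l‖ ≤ M := by
  have hr := restr_neg hY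
  have hn : ∀ l, resolv (-restr S Y hY) l = -resolv (restr S Y hY) (-l) := fun l => by
    rw [resolv_neg]
    rfl
  constructor
  · rintro ⟨hc, hi, hs, K, hK⟩
    rw [hr] at hs
    refine ⟨hc, fun l hl => ?_, K, fun l hl => ?_⟩
    · have h1 : -l ∈ spec (-restr S Y hY) := fun h => hl (by simpa using mem_rho_neg_iff.1 h)
      have h2 : (-l).re < 0 := hs h1
      show 0 < l.re
      simpa using h2
    · have := hK (-l) (by simpa using hl)
      rwa [hr, hn, norm_neg, neg_neg] at this
  · rintro ⟨hc, hs, K, hK⟩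
    refine ⟨hc, hY.neg, ?_, K, fun l hl => ?_⟩
    · rw [hr]
      intro l hl
      have h1 : -l ∈ spec (restr S Y hY) := fun h => hl (mem_rho_neg_iff.2 h)
      have h2 : 0 < (-l).re := hs h1
      show l.re < 0
      simpa using h2
    · rw [hr, hn, norm_neg]
      exact hK (-l) (by simpa using hl)

theorem isStrictlyDichotomousWrt_iff {Xp Xm : Submodule ℂ X} :
    IsStrictlyDichotomousWrt S Xp Xm ↔ (∀ l : ℂ, l.re = 0 → l ∈ rho S) ∧ IsCompl Xp Xm ∧
      IsStableOn (-S) Xp ∧ IsStableOn S Xm := by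
  constructor
  · intro H
    exact ⟨H.imaginary_axis, H.isCompl,
      (isStableOn_neg_iff H.inv_plus).2 ⟨H.closed_plus, H.spec_plus, H.bound_plus⟩,
      ⟨H.closed_minus, H.inv_minus, H.spec_minus, H.bound_minus⟩⟩
  · rintro ⟨h1, h2, hp, hm⟩
    have hi := invariant_neg_iff.1 hp.inv
    obtain ⟨hc, hs, hb⟩ := (isStableOn_neg_iff hi).1 hp
    exact ⟨hc, hm.closed, h2, h1, hi, hm.inv, hs, hm.spec_subset, hb, hm.bound⟩

/-! ### Spectral decomposition and the equivalences -/

variable [CompleteSpace X]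

/-- For x in Y the resolvent of S|Y supplies the bounded extension. It agrees with that of S where
both exist, and the gluing line Re = 0 lies in `rho S`, so the glued function is analytic there. -/
theorem IsStableOn.le_Gminus {Y : Submodule ℂ X} (hY : IsStableOn S Y)
    (haxis : ∀ l : ℂ, l.re = 0 → l ∈ rho S) : Y ≤ Gminus S := by
  intro x hx
  have := hY.closed.completeSpace_coe
  obtain ⟨K, hK⟩ := hY.bound
  have hrho : ∀ l : ℂ, 0 ≤ l.re → l ∈ rho (restr S Y hY.inv) := fun l hl => by
    by_contra hn
    exact not_lt.2 hl (hY.spec_subset hn)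
  have hagree : ∀ l ∈ rho S, l ∈ rho (restr S Y hY.inv) →
      (resolv (restr S Y hY.inv) l ⟨x, hx⟩ : X) = resolv S l x := fun l hl hl' => by
    obtain ⟨hd, hS⟩ := (isResolvent_resolv hl').1 ⟨x, hx⟩
    exact ((isResolvent_resolv hl).apply_eq hd (congrArg Subtype.val hS)).symm
  classical
  refine ⟨fun l => if 0 ≤ l.re then (resolv (restr S Y hY.inv) l ⟨x, hx⟩ : X) else resolv S l x,
    fun l hl => ?_, fun l hl => ?_, K * ‖x‖, fun l (hl : 0 ≤ l.re) => ?_⟩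
  · by_cases hlr : l ∈ rho S
    · refine (analyticOnNhd_resolv_apply S x l hlr).congr ?_
      filter_upwards [(isOpen_rho S).mem_nhds hlr] with z hz
      split_ifs with hz'
      · exact (hagree z hz (hrho z hz')).symm
      · rfl
    · have hl0 : 0 ≤ l.re := hl.resolve_right hlr
      have hl1 : 0 < l.re := hl0.lt_of_ne fun h0 => hlr (haxis l h0.symm)
      have h1 : DifferentiableOn ℂ (fun l => (resolv (restr S Y hY.inv) l ⟨x, hx⟩ : X))
          (rho (restr S Y hY.inv)) :=
        Y.subtypeL.differentiable.comp_differentiableOn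
          (analyticOnNhd_resolv_apply (restr S Y hY.inv) ⟨x, hx⟩).differentiableOn
      refine (h1.analyticOnNhd (isOpen_rho _) l (hrho l hl0)).congr ?_
      filter_upwards [(isOpen_lt_re 0).mem_nhds hl1] with z hz
      exact (if_pos (le_of_lt (mem_ofPred.1 hz))).symm
  · simp only
    split_ifs with hl'
    · exact hagree l hl (hrho l hl')
    · rfl
  · simp only [if_pos hl]
    exact ((resolv (restr S Y hY.inv) l).le_opNorm ⟨x, hx⟩).trans
      (mul_le_mul_of_nonneg_right (hK l hl) (norm_nonneg _))

theorem invariant_Gminus (hstrip : ∀ l : ℂ, |l.re| ≤ h → l ∈ rho S)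
    (hR : StripResolvent (resolv S) h M) : Invariant S (Gminus S) := by
  intro x hx
  rw [mem_Gminus_iff hstrip hR] at hx ⊢
  rwa [← hR.lineIntegral_resolvent_zero,
    (isResolvent_resolv (hstrip 0 hR.zero_mem)).zero_apply]

/-- The resolvent of the restriction of `S` to `G₋` is given by the continuation. -/
theorem isResolvent_restr_Gminus (hstrip : ∀ l : ℂ, |l.re| ≤ h → l ∈ rho S)
    (hR : StripResolvent (resolv S) h M) {l : ℂ} (hl : 0 ≤ l.re) :
    ∃ T : Gminus S →L[ℂ] Gminus S,
      IsResolvent (restr S (Gminus S) (invariant_Gminus hstrip hR)) l T ∧ ‖T‖ ≤ M := by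
  have hl' : -h < l.re := by linarith [hR.pos]
  have hker : ∀ {x : X}, x ∈ Gminus S ↔ lineIntegral (resolv S) h x = 0 :=
    mem_Gminus_iff hstrip hR
  have h0 := isResolvent_resolv (hstrip 0 hR.zero_mem)
  refine ⟨((continuation (resolv S) h l).comp (Gminus S).subtypeL).codRestrict (Gminus S)
    fun x => hker.2 (hR.lineIntegral_continuation (hker.1 x.2) hl'), ⟨fun y => ?_, fun x => ?_⟩,
    ContinuousLinearMap.opNorm_le_bound _ hR.bound_nonneg fun x =>
      hR.norm_continuation_apply_le (hker.1 x.2) hl⟩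
  · have h1 := hR.continuation_resolvent_equation (hker.1 y.2) hl'
    obtain ⟨hd, hS⟩ := h0.zero_mem_domain (y + l • continuation (resolv S) h l y)
    have hd' : continuation (resolv S) h l y ∈ S.domain := by rwa [h1]
    refine ⟨hd', Subtype.ext ?_⟩
    have h2 : S ⟨continuation (resolv S) h l y, hd'⟩ = y + l • continuation (resolv S) h l y := by
      rw [← hS]
      congr 1
      exact Subtype.ext h1
    show S ⟨continuation (resolv S) h l y, hd'⟩ - l • continuation (resolv S) h l y = y
    rw [h2, add_sub_cancel_right]
  · obtain ⟨⟨x, hx⟩, hxd⟩ := x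
    have hxd : x ∈ S.domain := hxd
    refine Subtype.ext ?_
    show continuation (resolv S) h l (S ⟨x, hxd⟩ - l • x) = x
    have hx0 := hker.1 hx
    have hy0 : lineIntegral (resolv S) h (S ⟨x, hxd⟩ - l • x) = 0 := by
      rw [map_sub, map_smul, hker.1 (invariant_Gminus hstrip hR ⟨x, hxd⟩ hx), hx0, smul_zero,
        sub_zero]
    -- S is unbounded and cannot be moved through the continuation, so the claim is tested after
    -- applying the injective R(0), which commutes with it and turns (S - l)x into x - lR(0)x.
    refine sub_eq_zero.1 (hR.eq_zero _ ?_)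
    rw [map_sub, ← hR.continuation_resolvent_zero hy0 hl', map_sub, map_smul, h0.zero_apply,
      map_sub, map_smul, hR.continuation_resolvent_zero hx0 hl']
    have h1 := hR.continuation_resolvent_equation hx0 hl'
    rw [map_add, map_smul] at h1
    rw [sub_eq_iff_eq_add.2 h1, sub_self]

theorem isStableOn_Gminus (hstrip : ∀ l : ℂ, |l.re| ≤ h → l ∈ rho S)
    (hR : StripResolvent (resolv S) h M) : IsStableOn S (Gminus S) where
  closed := isClosed_Gminus hstrip hR
  inv := invariant_Gminus hstrip hR
  spec_subset l hl := by
    by_contra hn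
    obtain ⟨T, hT, -⟩ := isResolvent_restr_Gminus hstrip hR (not_lt.1 hn)
    exact hl hT.mem_rho
  bound := ⟨M, fun l hl => by
    obtain ⟨T, hT, hM⟩ := isResolvent_restr_Gminus hstrip hR hl
    rwa [hT.resolv_eq]⟩

theorem isStrictlyDichotomousWrt_of_isCompl (hstrip : ∀ l : ℂ, |l.re| ≤ h → l ∈ rho S)
    (hR : StripResolvent (resolv S) h M) (hc : IsCompl (Gplus S) (Gminus S)) :
    IsStrictlyDichotomousWrt S (Gplus S) (Gminus S) := by
  refine isStrictlyDichotomousWrt_iff.2 ⟨fun l hl => hstrip l (by simpa [hl] using hR.pos.le), hc,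
    ?_, isStableOn_Gminus hstrip hR⟩
  rw [Gplus_eq_Gminus_neg]
  exact isStableOn_Gminus (mem_rho_neg_of_strip hstrip) hR.resolv_neg

theorem IsStrictlyDichotomousWrt.eq_and_eq {Xp Xm : Submodule ℂ X}
    (H : IsStrictlyDichotomousWrt S Xp Xm) (hd : Disjoint (Gplus S) (Gminus S)) :
    Xp = Gplus S ∧ Xm = Gminus S := by
  obtain ⟨haxis, hc, hp, hm⟩ := isStrictlyDichotomousWrt_iff.1 H
  have hm' : Xm ≤ Gminus S := hm.le_Gminus haxis
  have hp' : Xp ≤ Gplus S := by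
    rw [Gplus_eq_Gminus_neg]
    exact hp.le_Gminus fun l hl => mem_rho_neg_iff.2 (haxis _ (by simpa using hl))
  -- The modular law: enlarging both summands of a spanning pair while keeping them disjoint changes
  -- nothing.
  have key : ∀ {a b A B : Submodule ℂ X}, a ≤ A → b ≤ B → Disjoint A B → a ⊔ b = ⊤ → a = A :=
    fun ha hb hAB hab => eq_of_le_of_inf_le_of_sup_le ha
      (by rw [(hAB.mono_right hb).eq_bot]; exact bot_le) (by rw [hab]; exact le_top)
  exact ⟨key hp' hm' hd hc.sup_eq_top, key hm' hp' hd.symm (sup_comm Xp Xm ▸ hc.sup_eq_top)⟩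

theorem isCompl_of_isBounded_Pplus (hstrip : ∀ l : ℂ, |l.re| ≤ h → l ∈ rho S)
    (hR : StripResolvent (resolv S) h M) (hP : IsBounded (Pplus S h)) :
    IsCompl (Gplus S) (Gminus S) := by
  obtain ⟨B, hB⟩ := hP
  refine ⟨disjoint_Gplus_Gminus hstrip hR, codisjoint_iff.2 (Submodule.eq_top_iff'.2 fun x => ?_)⟩
  have hx : x ∈ (Pplus S h).domain := by rw [hB]; trivial
  have hx' : Aplus S h x ∈ (sq S).domain := hx
  have h0 := isResolvent_resolv (hstrip 0 hR.zero_mem)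
  have hy := resolvent_resolvent_sq h0 ⟨_, hx'⟩
  set y := sq S ⟨_, hx'⟩
  simp only [Aplus_eq_lineIntegral] at hy
  have hsum := DFunLike.congr_fun hR.lineIntegral_add_reflect x
  simp only [add_apply, mul_apply_eq_comp] at hsum
  have hAA := DFunLike.congr_fun hR.lineIntegral_mul_reflect x
  have hAA' := DFunLike.congr_fun hR.reflect.lineIntegral_mul_reflect x
  simp only [mul_apply_eq_comp, reflect_reflect, zero_apply] at hAA hAA'
  have hR0 : reflect (resolv S) 0 = -resolv S 0 := by simp [reflect]
  have hcancel : ∀ {z : X}, lineIntegral (reflect (resolv S)) h (resolv S 0 z) = 0 →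
      lineIntegral (reflect (resolv S)) h z = 0 := fun {z} hz =>
    hR.reflect.lineIntegral_resolvent_zero.1 (by rw [hR0, neg_apply, map_neg, hz, neg_zero])
  -- Here y = P₊x. Membership in either kernel may be tested after applying R(0)², where y becomes
  -- A₊x and x - y becomes A₋x.
  refine Submodule.mem_sup.2 ⟨y, (mem_Gplus_iff hstrip hR).2 (hcancel (hcancel ?_)), x - y,
    (mem_Gminus_iff hstrip hR).2 (hR.lineIntegral_resolvent_zero.1
      (hR.lineIntegral_resolvent_zero.1 ?_)), add_sub_cancel _ _⟩
  · rw [hy, hAA']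
  · rw [map_sub, map_sub, hy, ← hsum, add_sub_cancel_left, hAA]

theorem isBounded_Pplus_of_isCompl (hstrip : ∀ l : ℂ, |l.re| ≤ h → l ∈ rho S)
    (hR : StripResolvent (resolv S) h M) (hc : IsCompl (Gplus S) (Gminus S)) :
    IsBounded (Pplus S h) := by
  have h0 := isResolvent_resolv (hstrip 0 hR.zero_mem)
  have hclosed : IsClosed (Gplus S : Set X) := by
    rw [Gplus_eq_Gminus_neg]
    exact isClosed_Gminus (mem_rho_neg_of_strip hstrip) hR.resolv_neg
  -- Closed algebraic complements in a Banach space have bounded projections.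
  have htop : Submodule.IsTopCompl (Gplus S) (Gminus S) :=
    Submodule.IsCompl.isTopCompl_of_isClosed hc hclosed (isClosed_Gminus hstrip hR)
  set B : X →L[ℂ] X := (Gplus S).subtypeL.comp ((Gplus S).projectionOntoL (Gminus S) htop) with hB
  -- A₊ vanishes on G₋, and on G₊ it equals R(0)² since A₋ vanishes there.
  have hA : ∀ x, Aplus S h x = resolv S 0 (resolv S 0 (B x)) := fun x => by
    obtain ⟨p, hp, m, hm, rfl⟩ := Submodule.mem_sup.1
      (hc.sup_eq_top ▸ Submodule.mem_top : x ∈ Gplus S ⊔ Gminus S)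
    have hBp : B p = p := by
      simp [hB, Submodule.projectionOnto_apply_left hc ⟨p, hp⟩]
    have hBm : B m = 0 := by
      simp [hB, Submodule.projectionOnto_apply_right hc ⟨m, hm⟩]
    have hsum := DFunLike.congr_fun hR.lineIntegral_add_reflect p
    simp only [add_apply, mul_apply_eq_comp, (mem_Gplus_iff hstrip hR).1 hp, add_zero] at hsum
    rw [map_add, map_add, hBp, hBm, add_zero, Aplus_eq_lineIntegral, hsum,
      (mem_Gminus_iff hstrip hR).1 hm, add_zero]
  refine ⟨B, LinearPMap.ext (Submodule.eq_top_iff'.2 fun x => ?_) fun x hx _ => ?_⟩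
  · show Aplus S h x ∈ (sq S).domain
    rw [hA]
    exact mem_sq_domain h0 _
  · have hx' : Aplus S h x ∈ (sq S).domain := hx
    show sq S ⟨Aplus S h x, hx'⟩ = B x
    refine sub_eq_zero.1 (hR.eq_zero _ (hR.eq_zero _ ?_))
    rw [map_sub, map_sub, resolvent_resolvent_sq h0 ⟨_, hx'⟩, ← hA x, sub_self]

end Subspaces

end Dichotomy

end

theorem corollary4p2 {X : Type*} [NormedAddCommGroup X] [NormedSpace ℂ X] [CompleteSpace X]
    (S : X →ₗ.[ℂ] X) (h : ℝ) (hpos : 0 < h)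
    (hstrip : ∀ l : ℂ, |l.re| ≤ h → l ∈ Dichotomy.rho S)
    (hbound : ∃ M : ℝ, ∀ l : ℂ, |l.re| ≤ h → ‖Dichotomy.resolv S l‖ ≤ M) :
    [Dichotomy.IsStrictlyDichotomous S,
      IsCompl (Dichotomy.Gplus S) (Dichotomy.Gminus S),
      Dichotomy.IsBounded (Dichotomy.Pplus S h)].TFAE ∧
    (Dichotomy.IsStrictlyDichotomous S →
      ∀ Xp Xm : Submodule ℂ X, Dichotomy.IsStrictlyDichotomousWrt S Xp Xm ↔
        Xp = Dichotomy.Gplus S ∧ Xm = Dichotomy.Gminus S) := by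
  obtain ⟨M, hM⟩ := hbound
  have hR := Dichotomy.stripResolvent_resolv hpos hstrip hM
  have hd := Dichotomy.disjoint_Gplus_Gminus hstrip hR
  have hcompl : Dichotomy.IsStrictlyDichotomous S →
      IsCompl (Dichotomy.Gplus S) (Dichotomy.Gminus S) := by
    rintro ⟨Xp, Xm, H⟩
    obtain ⟨rfl, rfl⟩ := H.eq_and_eq hd
    exact H.isCompl
  refine ⟨?_, fun hS Xp Xm => ⟨fun H => H.eq_and_eq hd, ?_⟩⟩
  · tfae_have 1 → 2 := hcompl
    tfae_have 2 → 1 := fun hc =>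
      ⟨_, _, Dichotomy.isStrictlyDichotomousWrt_of_isCompl hstrip hR hc⟩
    tfae_have 2 → 3 := Dichotomy.isBounded_Pplus_of_isCompl hstrip hR
    tfae_have 3 → 2 := Dichotomy.isCompl_of_isBounded_Pplus hstrip hR
    tfae_finish
  · rintro ⟨rfl, rfl⟩
    exact Dichotomy.isStrictlyDichotomousWrt_of_isCompl hstrip hR (hcompl hS)
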